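/- Let $\Bbbk$ be a field of characteristic $0$ and let $n\ge 3$. Let $\mathbb Y^n$ be the set of partitions $\lambda=(\lambda_1\ge\dots\ge\lambda_n\ge 0)$ of length at most $n$, with $\lambda_{n+1}=0$, $|\lambda|=\sum_i\lambda_i$, and $\lambda\subseteq\mu$ if $\lambda_i\le\mu_i$ for all $i$. An $n$-grid is a map $\mho:\mathbb Y^n\to\Bbbk^n$. For $\lambda\in\mathbb Y^n$, an interpolation polynomial $F_\lambda(x_1,\dots,x_n\mid\mho)$ is a symmetric polynomial over $\Bbbk$ of degree at most $|\lambda|$ such that $F_\lambda(\mho(\mu)\mid\mho)=0$ for all $\mu\in\mathbb Y^n$ with $|\mu|\le|\lambda|$, $\mu\ne\lambda$, and $F_\lambda(\mho(\lambda)\mid\mho)\neq 0$. The grid is non-degenerate if such a polynomial exists for every $\lambda\in\mathbb Y^n$, and perfect if it is non-degenerate and every interpolation polynomial satisfies $F_\lambda(\mho(\mu)\mid\mho)=0$ for all $\mu\in\mathbb Y^n$ with $\lambda\not\subseteq\mu$. For partitions write $\mu\prec\lambda$ if $\lambda_r\ge\mu_r\ge\lambda_{r+1}$ for all $r$, and put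 $(q;q)_m=\prod_{j=1}^m(1-q^j)$. For a sequence $\mathcal A=(a_1,a_2,\dots)$ in $\Bbbk$ let $\tau\mathcal A=(a_2,a_3,\dots)$. For $q$ not a root of unity, the interpolation $q$-Whittaker polynomials are $\widetilde{\mathbb F}_\lambda(x_1,\dots,x_n\mid\mathcal A,\infty)=\widetilde{\mathbb F}_{\lambda/\varnothing}(x_1,\dots,x_n\mid\mathcal A,\infty)$, where, for $m\ge1$, $$\widetilde{\mathbb F}_{\lambda/\nu}(x_1,\dots,x_m\mid\mathcal A,\infty)=\sum_{\mu\prec\lambda}\widetilde{\mathbb F}_{\lambda/\mu}(x_1\mid\mathcal A,\infty)\,\widetilde{\mathbb F}_{\mu/\nu}(x_2,\dots,x_m\mid\tau\mathcal A,\infty),$$ the function of zero variables is $\delta_{\lambda\nu}$, and for $\mu\prec\lambda$ $$\widetilde{\mathbb F}_{\lambda/\mu}(x\mid\mathcal A,\infty)=\prod_{r\ge1}\frac{(q;q)_{\mu_r-\mu_{r+1}}\prod_{j=0}^{\lambda_r-\mu_r-1}(x-a_rq^j)}{(q;q)_{\lambda_r-\mu_r}(q;q)_{\mu_r-\lambda_{r+1}}}.$$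 For $d\in\Bbbk$ and a sequence $\mathcal C=(c_1,c_2,\dots)$ in $\Bbbk$, the interpolation elementary polynomials $\mathbb F^{el}_\lambda(x_1,\dots,x_n\mid\mathcal C,\infty)$ are defined by the same recursion from $$\mathbb F^{el}_{\lambda/\mu}(x\mid\mathcal C,\infty)=\prod_{r\ge1}\frac{(\mu_r-\mu_{r+1})!\,\prod_{j=0}^{\lambda_r-\mu_r-1}(x-c_r-jd)}{(\lambda_r-\mu_r)!\,(\mu_r-\lambda_{r+1})!}\qquad(\mu\prec\lambda).$$ Assume that $\mho$ is an $n$-grid of the form $$\mho(\lambda)=(f_1(\lambda_1-\lambda_2),f_2(\lambda_2-\lambda_3),\dots,f_n(\lambda_n))$$ for functions $f_i:\mathbb Z_{\ge0}\to\Bbbk$. Then $\mho$ is perfect if and only if the functions $f_i$ have one of the following two forms: 1. $f_i(k)=c+a_iq^k$ for constants $c,q,a_1,\dots,a_n\in\Bbbk$ such that $q\ne0$ is not a root of unity, all $a_i\neq 0$, and $a_i/a_j\ne q^k$ for all $i\ne j$ and $k\in\mathbb Z$. In this case the polynomials $F_\lambda(x_1,\dots,x_n\mid\mho)$ are exactly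 the nonzero scalar multiples of $\widetilde{\mathbb F}_\lambda(x_1-c,\dots,x_n-c\mid\mathcal A,\infty)$, where $\mathcal A$ is any sequence whose first $n$ terms are $a_1,\dots,a_n$. 2. $f_i(k)=c_i+kd$ for constants $d,c_1,\dots,c_n\in\Bbbk$ such that $d\ne0$ and $c_i-c_j\ne kd$ for all $i\neq j$ and $k\in\mathbb Z$. In this case the polynomials $F_\lambda(x_1,\dots,x_n\mid\mho)$ are exactly the nonzero scalar multiples of $\mathbb F^{el}_\lambda(x_1,\dots,x_n\mid\mathcal C,\infty)$, where $\mathcal C$ is any sequence whose first $n$ terms are $c_1,\dots,c_n$. -/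

import Mathlib

/-- Partitions `lam 0 ≥ lam 1 ≥ ⋯ ≥ lam (n - 1) ≥ 0` of length at most `n` (indices start at `0`).
The order `≤` of this subtype is the pointwise one, i.e. inclusion of Young diagrams. -/
abbrev Ptn (n : ℕ) : Type := {lam : Fin n → ℕ // Antitone lam}

/-- The number `|lam|` of boxes. -/
def Ptn.size {n : ℕ} (lam : Ptn n) : ℕ := ∑ i, lam.1 i

/-- The part following the one with index `i`; it is `0` after the last index. -/
def nextPart {n : ℕ} (v : Fin n → ℕ) (i : Fin n) : ℕ :=
  if h : (i : ℕ) + 1 < n then v ⟨(i : ℕ) + 1, h⟩ else 0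

/-- `F` is an interpolation polynomial with index `lam` for the grid `Om`: it is symmetric of
degree at most `|lam|`, vanishes at `Om mu` for all `mu ≠ lam` with `|mu| ≤ |lam|`,
and does not vanish at `Om lam`. -/
structure IsInterpolation {k : Type*} [Field k] {n : ℕ} (Om : Ptn n → Fin n → k) (lam : Ptn n)
    (F : MvPolynomial (Fin n) k) : Prop where
  symmetric : F.IsSymmetric
  degree_le : F.totalDegree ≤ lam.size
  eval_eq_zero : ∀ mu : Ptn n, mu.size ≤ lam.size → mu ≠ lam → MvPolynomial.eval (Om mu) F = 0
  eval_ne_zero : MvPolynomial.eval (Om lam) F ≠ 0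

/-- Non-degenerate grids: interpolation polynomials exist for all indices. -/
def IsNondegenerate {k : Type*} [Field k] {n : ℕ} (Om : Ptn n → Fin n → k) : Prop :=
  ∀ lam : Ptn n, ∃ F : MvPolynomial (Fin n) k, IsInterpolation Om lam F

/-- Perfect grids: non-degenerate, and the interpolation polynomial with index `lam` vanishes at
`Om mu` unless `lam ⊆ mu`. -/
def IsPerfect {k : Type*} [Field k] {n : ℕ} (Om : Ptn n → Fin n → k) : Prop :=
  IsNondegenerate Om ∧
    ∀ (lam : Ptn n) (F : MvPolynomial (Fin n) k), IsInterpolation Om lam F →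
      ∀ mu : Ptn n, ¬ lam ≤ mu → MvPolynomial.eval (Om mu) F = 0

/-- `mu ≺ lam`: `lam 0 ≥ mu 0 ≥ lam 1 ≥ mu 1 ≥ ⋯`. -/
abbrev Interlaces {n : ℕ} (mu lam : Fin n → ℕ) : Prop :=
  ∀ r, nextPart lam r ≤ mu r ∧ mu r ≤ lam r

/-- The branching rule
`F_{lam/nu}(x_1, …, x_m | A) = ∑_{mu ≺ lam} F_{lam/mu}(x_1 | A) F_{mu/nu}(x_2, …, x_m | τA)`,
where `τ` drops the first parameter and `F_{lam/nu}( | A)` is `1` if `lam = nu` and `0` otherwise.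
The argument `w` gives the one-variable functions: `w A x lam mu` is `F_{lam/mu}(x | A)`. -/
def branching {k R : Type*} [CommRing R] {n : ℕ}
    (w : (ℕ → k) → R → (Fin n → ℕ) → (Fin n → ℕ) → R) :
    (m : ℕ) → (Fin m → R) → (ℕ → k) → (Fin n → ℕ) → (Fin n → ℕ) → R
  | 0, _, _, lam, nu => if lam = nu then 1 else 0
  | m + 1, x, A, lam, nu =>
      ∑ mu ∈ Finset.Icc (nextPart lam) lam,
        w A (x 0) lam mu * branching w m (fun i => x i.succ) (fun i => A (i + 1)) mu nu

/-- The `q`-Pochhammer symbol `(q; q)_m = (1 - q) (1 - q ^ 2) ⋯ (1 - q ^ m)`. -/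
def qqPoch {k : Type*} [Field k] (q : k) (m : ℕ) : k := ∏ j ∈ Finset.range m, (1 - q ^ (j + 1))

/-- One-variable interpolation `q`-Whittaker function
`x^{|lam| - |mu|} ∏_r (a_r / x; q)_{lam_r - mu_r} (q; q)_{mu_r - mu_{r+1}} /
  ((q; q)_{lam_r - mu_r} (q; q)_{mu_r - lam_{r+1}})` for `mu ≺ lam`, and `0` otherwise.
The powers of `x` are distributed: `x^s (a / x; q)_s = ∏_{j < s} (x - a q^j)`. -/
def qWhittakerOne {k R : Type*} [Field k] [CommRing R] [Algebra k R] {n : ℕ} (q : k)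
    (A : ℕ → k) (x : R) (lam mu : Fin n → ℕ) : R :=
  if Interlaces mu lam then
    ∏ r : Fin n,
      ((∏ j ∈ Finset.range (lam r - mu r), (x - algebraMap k R (A r * q ^ j))) *
        algebraMap k R (qqPoch q (mu r - nextPart mu r) /
          (qqPoch q (lam r - mu r) * qqPoch q (mu r - nextPart lam r))))
  else 0

/-- The interpolation `q`-Whittaker polynomial `F_lam(x_1, …, x_n | A, ∞)`; the parameter `a_i` of
`x_i` is `A (i - 1)`. -/
def qWhittakerInterp {k R : Type*} [Field k] [CommRing R] [Algebra k R] {n : ℕ} (q : k)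
    (A : ℕ → k) (x : Fin n → R) (lam : Ptn n) : R :=
  branching (qWhittakerOne q) n x A lam.1 0

/-- One-variable interpolation elementary function
`∏_r (mu_r - mu_{r+1})! ∏_{j < lam_r - mu_r} (x - c_r - j d) /
  ((lam_r - mu_r)! (mu_r - lam_{r+1})!)` for `mu ≺ lam`, and `0` otherwise. -/
def elementaryOne {k R : Type*} [Field k] [CommRing R] [Algebra k R] {n : ℕ} (d : k)
    (C : ℕ → k) (x : R) (lam mu : Fin n → ℕ) : R :=
  if Interlaces mu lam then
    ∏ r : Fin n,
      ((∏ j ∈ Finset.range (lam r - mu r), (x - algebraMap k R (C r + (j : k) * d))) *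
        algebraMap k R (((mu r - nextPart mu r).factorial : k) /
          (((lam r - mu r).factorial : k) * ((mu r - nextPart lam r).factorial : k))))
  else 0

/-- The interpolation elementary polynomial `F^{el}_lam(x_1, …, x_n | C, ∞)`; the parameter `c_i` of
`x_i` is `C (i - 1)`. -/
def elementaryInterp {k R : Type*} [Field k] [CommRing R] [Algebra k R] {n : ℕ} (d : k)
    (C : ℕ → k) (x : Fin n → R) (lam : Ptn n) : R :=
  branching (elementaryOne d) n x C lam.1 0

/-- The functions `f i` have the form `f i j = c + a i * q ^ j`, where `q` is nonzero and not a root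
of unity, all `a i` are nonzero, and no `a i / a j` with `i ≠ j` is an integer power of `q`. -/
structure IsGeometricType {k : Type*} [Field k] {n : ℕ} (f : Fin n → ℕ → k)
    (c q : k) (a : Fin n → k) : Prop where
  form : ∀ i j, f i j = c + a i * q ^ j
  q_ne_zero : q ≠ 0
  not_root_of_unity : ∀ m : ℕ, 0 < m → q ^ m ≠ 1
  a_ne_zero : ∀ i, a i ≠ 0
  ratio_ne : ∀ i j, i ≠ j → ∀ z : ℤ, a i / a j ≠ q ^ z

/-- The functions `f i` have the form `f i j = c i + j * d`, where `d ≠ 0` and no `c i - c j` with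
`i ≠ j` is an integer multiple of `d`. -/
structure IsArithmeticType {k : Type*} [Field k] {n : ℕ} (f : Fin n → ℕ → k)
    (d : k) (c : Fin n → k) : Prop where
  form : ∀ i j, f i j = c i + (j : k) * d
  d_ne_zero : d ≠ 0
  diff_ne : ∀ i j, i ≠ j → ∀ z : ℤ, c i - c j ≠ (z : k) * d

/-! ### Calculus of shifted factorials of an affine map -/

section AffineCalculus

open Finset

variable {k : Type*} [Field k]

/-! Both families are instances of one: for an affine map T u = q u + d they are the grids f_i(k) =
T^k(a_i) whose T-orbits are injective and pairwise disjoint. For q = 1 the orbits are arithmetic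
progressions; for q ≠ 1 they are geometric progressions around the fixed point of T. The two kinds
of polynomials are likewise instances of `affInterp`, built from the factors x - T^j(a_r).

Sufficiency. The branching rule itself shows where `affInterp` vanishes (`affBranching_vanishing`)
and that it does not vanish at its own index (`affBranching_ne_zero`). The hard point is symmetry.
It reduces to two adjacent variables; there the sum over intermediate partitions is a product of
transfer matrices along the rows, and a local exchange relation
(`sum_affDivSub_mul_exchangeWeight`), resting on the q-Vandermonde identity, carries a correction
operator from the first row to the last, where it disappears. A dimension count
(`IsNondegenerate.eq_zero`) shows that interpolation polynomials are unique up to scalars, so every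
one of them is a multiple of `affInterp` and the grid is perfect.

Necessity. Let L be the last index. The interpolation polynomial with index (l + t, t, …, t)
vanishes on all hyperplanes x_i = f_L(j) with j < t. Dividing by these factors leaves a symmetric
polynomial of degree at most l that vanishes at all points (f_i(e_i)) with e_L ≥ t and ∑ e_i < l + t
(`IsPerfect.exists_row`). For l = 2 these zeros force one affine map T with f_L(t + 1) = T f_L(t)
for all t and f_i(1) = T f_i(0) for all i (`IsPerfect.exists_affMap`). For t = 0 and larger l,
comparison with `affInterp` on a coordinate plane gives f_i(a) = T^a f_i(0) by induction on a
(`IsPerfect.eq_iterate`). Non-degeneracy then separates the orbits, and the cases q = 1 and q ≠ 1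
are the two families. -/

/-- The affine map `u ↦ q u + d`. -/
def affMap (q d u : k) : k := q * u + d

/-- The shifted factorial `∏_{j < N} (y - T^j a)` of the affine map `T = affMap q d`. -/
def affPoch (q d : k) (N : ℕ) (y a : k) : k := ∏ j ∈ range N, (y - (affMap q d)^[j] a)

/-- The multiple `β (1 + q + ⋯ + q ^ (j - 1))` of a `q`-number. -/
def qNat (q β : k) (j : ℕ) : k := β * ∑ i ∈ range j, q ^ i

/-- The factorial of the numbers `qNat q β j`. -/
def qFact (q β : k) (N : ℕ) : k := ∏ j ∈ range N, qNat q β (j + 1)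

/-- The divided shifted factorial. -/
def affDiv (q d β : k) (N : ℕ) (y a : k) : k := affPoch q d N y a / qFact q β N

/-- The divided shifted factorial of order `N - M`, and `0` if `N < M`. -/
def affDivSub (q d β : k) (y a : k) (N M : ℕ) : k :=
  if M ≤ N then affDiv q d β (N - M) y a else 0

/-- The inverse factorial of order `N - M`, and `0` if `N < M`. -/
def qFactInvSub (q β : k) (N M : ℕ) : k := if M ≤ N then (qFact q β (N - M))⁻¹ else 0

/-- The Gaussian binomial coefficient. -/
def gaussChoose (q β : k) (n r : ℕ) : k :=
  if r ≤ n then qFact q β n / (qFact q β r * qFact q β (n - r)) else 0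

variable {q d β : k}

lemma affMap_iterate_sub (j : ℕ) (u v : k) :
    (affMap q d)^[j] u - (affMap q d)^[j] v = q ^ j * (u - v) := by
  induction j with
  | zero => simp
  | succ j ih =>
    rw [Function.iterate_succ_apply', Function.iterate_succ_apply', pow_succ]
    simp only [affMap]
    linear_combination q * ih

lemma affPoch_succ (N : ℕ) (y a : k) :
    affPoch q d (N + 1) y a = affPoch q d N y a * (y - (affMap q d)^[N] a) :=
  prod_range_succ _ _

lemma affPoch_add (l m : ℕ) (y a : k) :
    affPoch q d (l + m) y a = affPoch q d l y a * affPoch q d m y ((affMap q d)^[l] a) := by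
  unfold affPoch
  rw [prod_range_add]
  congr 1
  refine prod_congr rfl fun j _ => ?_
  rw [add_comm, Function.iterate_add_apply]

lemma qNat_add (m n : ℕ) : qNat q β (m + n) = qNat q β m + q ^ m * qNat q β n := by
  unfold qNat
  rw [sum_range_add, mul_add, mul_sum, mul_sum, mul_sum, mul_sum]
  congr 1
  refine sum_congr rfl fun i _ => ?_
  rw [pow_add]; ring

@[simp] lemma qNat_zero : qNat q β 0 = 0 := by simp [qNat]

@[simp] lemma qFact_zero : qFact q β 0 = 1 := by simp [qFact]

lemma qFact_succ (N : ℕ) : qFact q β (N + 1) = qFact q β N * qNat q β (N + 1) :=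
  prod_range_succ _ _

lemma qFact_ne_zero (hB : ∀ j, qNat q β (j + 1) ≠ 0) (N : ℕ) : qFact q β N ≠ 0 :=
  prod_ne_zero_iff.2 fun j _ => hB j

@[simp] lemma affDiv_zero (y a : k) : affDiv q d β 0 y a = 1 := by simp [affDiv, affPoch]

lemma qNat_mul_affDiv_succ (hB : ∀ j, qNat q β (j + 1) ≠ 0) (N : ℕ) (y a : k) :
    qNat q β (N + 1) * affDiv q d β (N + 1) y a =
      affDiv q d β N y a * (y - (affMap q d)^[N] a) := by
  have h1 := qFact_ne_zero hB N
  have h2 := hB N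
  rw [affDiv, affDiv, qFact_succ, affPoch_succ]
  field_simp

/-- A form of the q-binomial theorem. After multiplication by [N+1], the splitting [N+1] = [N+1-i] +
q^(N+1-i) [i] lowers one of the two orders in each half, and the linear factors recombine: (y -
T^(N-i) x) + q^(N-i) (x - T^i a) = y - T^N a. -/
lemma sum_affDiv_mul_affDiv (hB : ∀ j, qNat q β (j + 1) ≠ 0) (N : ℕ) (y x a : k) :
    ∑ i ∈ range (N + 1), affDiv q d β (N - i) y x * affDiv q d β i x a = affDiv q d β N y a := by
  induction N with
  | zero => simp
  | succ N ih =>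
    have key : qNat q β (N + 1) *
        ∑ i ∈ range (N + 1 + 1), affDiv q d β (N + 1 - i) y x * affDiv q d β i x a =
        (y - (affMap q d)^[N] a) * affDiv q d β N y a := by
      have split : ∀ i ∈ range (N + 1 + 1),
          qNat q β (N + 1) * (affDiv q d β (N + 1 - i) y x * affDiv q d β i x a) =
          qNat q β (N + 1 - i) * affDiv q d β (N + 1 - i) y x * affDiv q d β i x a +
          q ^ (N + 1 - i) * affDiv q d β (N + 1 - i) y x * (qNat q β i * affDiv q d β i x a) := by
        intro i hi
        have : N + 1 = (N + 1 - i) + i := by have := mem_range.1 hi; omega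
        have h2 : qNat q β (N + 1) = qNat q β (N + 1 - i) + q ^ (N + 1 - i) * qNat q β i := by
          conv_lhs => rw [this]
          exact qNat_add _ _
        rw [h2]; ring
      rw [mul_sum, sum_congr rfl split, sum_add_distrib, sum_range_succ, Nat.sub_self, qNat_zero,
        sum_range_succ' (fun i => q ^ (N + 1 - i) * affDiv q d β (N + 1 - i) y x *
          (qNat q β i * affDiv q d β i x a)), qNat_zero, ← ih, mul_sum]
      simp only [zero_mul, mul_zero, add_zero]
      rw [← sum_add_distrib]
      refine sum_congr rfl fun i hi => ?_
      have hi' := mem_range.1 hi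
      have e1 : N + 1 - i = (N - i) + 1 := by omega
      rw [e1, Nat.add_sub_add_right, qNat_mul_affDiv_succ hB,
        qNat_mul_affDiv_succ hB]
      have e3 : (affMap q d)^[N] a = (affMap q d)^[N - i] ((affMap q d)^[i] a) := by
        rw [← Function.iterate_add_apply]; congr 2; omega
      have := affMap_iterate_sub (q := q) (d := d) (N - i) x ((affMap q d)^[i] a)
      rw [e3]
      linear_combination (-affDiv q d β (N - i) y x * affDiv q d β i x a) * this
    have h1 := qNat_mul_affDiv_succ (d := d) hB N y a
    refine mul_left_cancel₀ (hB N) ?_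
    rw [key, h1]; ring

lemma affDivSub_of_lt {y a : k} {N M : ℕ} (h : N < M) : affDivSub q d β y a N M = 0 :=
  if_neg (by omega)

lemma affDivSub_of_le {y a : k} {N M : ℕ} (h : M ≤ N) :
    affDivSub q d β y a N M = affDiv q d β (N - M) y a := if_pos h

lemma qFactInvSub_of_lt {N M : ℕ} (h : N < M) : qFactInvSub q β N M = 0 := if_neg (by omega)

lemma qFactInvSub_of_le {N M : ℕ} (h : M ≤ N) :
    qFactInvSub q β N M = (qFact q β (N - M))⁻¹ := if_pos h

/-- Divided shifted factorials compose like transition matrices. -/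
lemma sum_affDivSub_mul_affDivSub (hB : ∀ j, qNat q β (j + 1) ≠ 0) {N K : ℕ} (hN : N < K) (M : ℕ)
    (y x a : k) :
    ∑ i ∈ range K, affDivSub q d β y x N i * affDivSub q d β x a i M =
      affDivSub q d β y a N M := by
  have h0 : ∑ i ∈ range K, affDivSub q d β y x N i * affDivSub q d β x a i M =
      ∑ i ∈ range (N + 1), affDivSub q d β y x N i * affDivSub q d β x a i M := by
    symm
    refine sum_subset (range_subset_range.2 hN) fun i _ hi => ?_
    rw [affDivSub_of_lt (by simpa using hi), zero_mul]
  rw [h0]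
  rcases lt_or_ge N M with h | h
  · rw [affDivSub_of_lt h]
    refine sum_eq_zero fun i hi => ?_
    have := mem_range.1 hi
    rw [affDivSub_of_lt (N := i) (by omega), mul_zero]
  · obtain ⟨R, rfl⟩ := Nat.exists_eq_add_of_le h
    rw [affDivSub_of_le h, Nat.add_sub_cancel_left, add_assoc, sum_range_add,
      sum_eq_zero (s := range M), zero_add, ← sum_affDiv_mul_affDiv hB R y x a]
    · refine sum_congr rfl fun i hi => ?_
      have := mem_range.1 hi
      rw [affDivSub_of_le (by omega), affDivSub_of_le (by omega)]
      congr 2 <;> omega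
    · intro i hi
      rw [affDivSub_of_lt (N := i) (mem_range.1 hi), mul_zero]

lemma gaussChoose_zero_right (hB : ∀ j, qNat q β (j + 1) ≠ 0) (n : ℕ) :
    gaussChoose q β n 0 = 1 := by
  simp [gaussChoose, qFact_ne_zero hB]

lemma gaussChoose_of_lt {n r : ℕ} (h : n < r) : gaussChoose q β n r = 0 := if_neg (by omega)

/-- The q-Pascal rule, from [n+1] = [n-r] + q^(n-r) [r+1]. -/
lemma gaussChoose_succ_succ (hB : ∀ j, qNat q β (j + 1) ≠ 0) (n r : ℕ) :
    gaussChoose q β (n + 1) (r + 1) =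
      gaussChoose q β n (r + 1) + q ^ (n - r) * gaussChoose q β n r := by
  have hF := qFact_ne_zero hB
  rcases lt_trichotomy n r with h | rfl | h
  · rw [gaussChoose_of_lt (by omega), gaussChoose_of_lt (by omega), gaussChoose_of_lt h]; simp
  · rw [gaussChoose_of_lt (Nat.lt_succ_self n)]
    simp [gaussChoose, hF]
  · obtain ⟨m, rfl⟩ := Nat.exists_eq_add_of_lt h
    have e1 : r + m + 1 - r = m + 1 := by omega
    have e2 : r + m + 1 - (r + 1) = m := by omega
    have e3 : r + m + 1 + 1 - (r + 1) = m + 1 := by omega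
    have e4 : qNat q β (r + m + 1 + 1) = qNat q β (m + 1) + q ^ (m + 1) * qNat q β (r + 1) := by
      rw [← qNat_add]; congr 1; omega
    simp only [gaussChoose]
    rw [if_pos (by omega), if_pos (by omega), if_pos (by omega), e1, e2, e3,
      qFact_succ (r + m + 1), e4, qFact_succ r, qFact_succ m]
    have h1 := hF r
    have h2 := hF m
    have h3 := hB r
    have h4 := hB m
    field_simp

/-- The `q`-Vandermonde identity. -/
lemma gaussChoose_add (hB : ∀ j, qNat q β (j + 1) ≠ 0) (m n r : ℕ) :
    gaussChoose q β (m + n) r = ∑ l ∈ range (r + 1),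
      q ^ (l * (m + l - r)) * gaussChoose q β n l * gaussChoose q β m (r - l) := by
  induction n generalizing r with
  | zero =>
    rw [sum_eq_single_of_mem 0 (by simp)]
    · simp [gaussChoose_zero_right hB]
    · intro l _ hl
      rw [gaussChoose_of_lt (n := 0) (by omega)]; ring
  | succ n ih =>
    cases r with
    | zero => simp [gaussChoose_zero_right hB]
    | succ r =>
      rw [← add_assoc, gaussChoose_succ_succ hB, ih, ih, sum_range_succ', sum_range_succ' _ (r + 1),
        gaussChoose_zero_right hB, gaussChoose_zero_right hB, mul_sum, add_right_comm,
        ← sum_add_distrib]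
      congr 1
      refine sum_congr rfl fun l hl => ?_
      have hl' := mem_range.1 hl
      rw [gaussChoose_succ_succ hB]
      have e1 : r + 1 - (l + 1) = r - l := by omega
      have e2 : m + (l + 1) - (r + 1) = m + l - r := by omega
      rw [e1, e2]
      -- The exponents contain truncated subtractions. The identity `e3` needs r - l ≤ m and l ≤ n;
      -- otherwise a Gaussian coefficient is zero.
      rcases lt_or_ge m (r - l) with h | h
      · rw [gaussChoose_of_lt h]; ring
      rcases lt_or_ge n l with h' | h'
      · rw [gaussChoose_of_lt h']; ring
      have e3 : q ^ (m + n - r) * q ^ (l * (m + l - r)) =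
          q ^ ((l + 1) * (m + l - r)) * q ^ (n - l) := by
        rw [← pow_add, ← pow_add]
        congr 1
        have : m + n - r = (m + l - r) + (n - l) := by omega
        rw [this]; ring
      linear_combination (gaussChoose q β n l * gaussChoose q β m (r - l)) * e3

end AffineCalculus

/-! ### The local exchange relation -/

section Exchange

open Finset

variable {k : Type*} [Field k] {q d β : k}

/-- The symmetric form of a truncated convolution of divided shifted factorials with a Gaussian
binomial coefficient. -/
lemma sum_affDiv_mul_gaussChoose (hB : ∀ j, qNat q β (j + 1) ≠ 0) (M N e : ℕ) (x y a : k) :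
    affDiv q d β N y a * (qFact q β e)⁻¹ * ∑ i ∈ range (M + 1),
      affDiv q d β (M - i) y x * affDiv q d β i x a * (qFact q β N * gaussChoose q β (i + e) N) =
    ∑ l ∈ range (M + N + 1), q ^ (l * (e + l - N)) * qFactInvSub q β (e + l) N *
      qFactInvSub q β N l * qFactInvSub q β M l * affDiv q d β l x a * affPoch q d l y a *
      affPoch q d (N - l) y ((affMap q d)^[l] a) * affPoch q d (M - l) y ((affMap q d)^[l] a) := by
  have hF := qFact_ne_zero hB
  -- By q-Vandermonde the coefficient with top i + e becomes a sum over l of coefficients with top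
  -- i. Such a coefficient times the factorial of order i from a splits into orders l from a and i -
  -- l from T^l a, so the sum over i is an instance of the composition rule.
  have expand : ∀ i ∈ range (M + 1),
      affDiv q d β (M - i) y x * affDiv q d β i x a * (qFact q β N * gaussChoose q β (i + e) N) =
      ∑ l ∈ range (N + 1), qFact q β N * q ^ (l * (e + l - N)) * gaussChoose q β e (N - l) *
        affDiv q d β l x a * (affDivSub q d β y x M i *
          affDivSub q d β x ((affMap q d)^[l] a) i l) := by
    intro i hi
    rw [add_comm i e, gaussChoose_add hB, mul_sum, mul_sum]
    refine sum_congr rfl fun l _ => ?_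
    rw [affDivSub_of_le (N := M) (by have := mem_range.1 hi; omega)]
    rcases lt_or_ge i l with h | h
    · rw [gaussChoose_of_lt h, affDivSub_of_lt h]; ring
    · rw [affDivSub_of_le h, gaussChoose, if_pos h]
      have e1 : affPoch q d i x a =
          affPoch q d l x a * affPoch q d (i - l) x ((affMap q d)^[l] a) := by
        rw [← affPoch_add]; congr 1; omega
      simp only [affDiv]
      rw [e1]
      have h1 := hF i
      have h2 := hF l
      have h3 := hF (i - l)
      field_simp
  rw [sum_congr rfl expand, sum_comm, mul_sum]
  symm
  -- The natural range is l ≤ N. The longer range adds only zeros and makes the bound symmetric in M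
  -- and N.
  refine (sum_subset (range_subset_range.2 (by omega : N + 1 ≤ M + N + 1))
    fun l _ hl => ?_).symm.trans (sum_congr rfl fun l hl => ?_)
  · rw [qFactInvSub_of_lt (N := N) (by simpa using hl)]; ring
  · have hl' : l ≤ N := by have := mem_range.1 hl; omega
    rw [← mul_sum, sum_affDivSub_mul_affDivSub hB (Nat.lt_succ_self M), qFactInvSub_of_le hl']
    rcases lt_or_ge (e + l) N with h | h
    · rw [qFactInvSub_of_lt h, gaussChoose_of_lt (by omega)]; ring
    rcases lt_or_ge M l with h' | h'
    · rw [qFactInvSub_of_lt h', affDivSub_of_lt h']; ring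
    · rw [qFactInvSub_of_le h, qFactInvSub_of_le h', affDivSub_of_le h', gaussChoose,
        if_pos (by omega)]
      simp only [affDiv]
      have e1 : affPoch q d N y a =
          affPoch q d l y a * affPoch q d (N - l) y ((affMap q d)^[l] a) := by
        rw [← affPoch_add]; congr 1; omega
      have e2 : e - (N - l) = e + l - N := by omega
      rw [e1, e2]
      have h1 := hF N
      have h2 := hF l
      have h3 := hF (N - l)
      have h4 := hF (M - l)
      have h5 := hF (e + l - N)
      have h6 := hF e
      field_simp

lemma qFact_mul_qFactInvSub (hB : ∀ j, qNat q β (j + 1) ≠ 0) (n r : ℕ) :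
    qFact q β n * qFactInvSub q β n r = qFact q β r * gaussChoose q β n r := by
  rcases lt_or_ge n r with h | h
  · rw [qFactInvSub_of_lt h, gaussChoose_of_lt h]; ring
  · rw [qFactInvSub_of_le h, gaussChoose, if_pos h]
    have h1 := qFact_ne_zero hB r
    have h2 := qFact_ne_zero hB (n - r)
    field_simp

/-- The local weight of the two-step branching rule: `i`, `s` and `p`, `j` are consecutive parts of
the intermediate, the inner and the outer, the intermediate partition. -/
def exchangeWeight (q d β x y a : k) (p s i j : ℕ) : k :=
  qFactInvSub q β i p * affDivSub q d β y a i s * qFact q β (i - j) * qFactInvSub q β s j *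
    affDivSub q d β x a p j

/-- The exchange relation between the local weights with `x` and `y` interchanged. -/
lemma sum_affDivSub_mul_exchangeWeight (hB : ∀ j, qNat q β (j + 1) ≠ 0) {K i p : ℕ} (hi : i < K)
    (hp : p < K) (s j : ℕ) (x y a : k) :
    ∑ i' ∈ range K, affDivSub q d β y x i i' * exchangeWeight q d β y x a p s i' j =
      ∑ j' ∈ range K, exchangeWeight q d β x y a p s i j' * affDivSub q d β y x j' j := by
  unfold exchangeWeight
  -- Both sides vanish term by term unless p, s ≤ i and j ≤ p, s; the next four case splits dispose
  -- of everything else.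
  rcases lt_or_ge i p with h | hip
  · rw [sum_eq_zero, sum_eq_zero]
    · intro j' _
      rw [qFactInvSub_of_lt h]; ring
    · intro i' _
      rcases lt_or_ge i i' with h' | h'
      · rw [affDivSub_of_lt h']; ring
      · rw [qFactInvSub_of_lt (N := i') (by omega)]; ring
  rcases lt_or_ge i s with h | his
  · rw [sum_eq_zero, sum_eq_zero]
    · intro j' _
      rw [affDivSub_of_lt h]; ring
    · intro i' _
      rcases lt_or_ge i i' with h' | h'
      · rw [affDivSub_of_lt h']; ring
      · rw [affDivSub_of_lt (N := i') (M := s) (by omega)]; ring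
  rcases lt_or_ge p j with h | hjp
  · rw [sum_eq_zero, sum_eq_zero]
    · intro j' _
      rcases lt_or_ge p j' with h' | h'
      · rw [affDivSub_of_lt h']; ring
      · rw [affDivSub_of_lt (N := j') (by omega)]; ring
    · intro i' _
      rw [affDivSub_of_lt h]; ring
  rcases lt_or_ge s j with h | hjs
  · rw [sum_eq_zero, sum_eq_zero]
    · intro j' _
      rcases lt_or_ge s j' with h' | h'
      · rw [qFactInvSub_of_lt h']; ring
      · rw [affDivSub_of_lt (N := j') (by omega)]; ring
    · intro i' _
      rw [qFactInvSub_of_lt h]; ring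
  obtain ⟨M, rfl⟩ := Nat.exists_eq_add_of_le his
  obtain ⟨N, rfl⟩ := Nat.exists_eq_add_of_le hjp
  obtain ⟨e, rfl⟩ := Nat.exists_eq_add_of_le hjs
  obtain ⟨e', he'⟩ := Nat.exists_eq_add_of_le hip
  have lhs : ∑ i' ∈ range K, affDivSub q d β y x (j + e + M) i' *
      (qFactInvSub q β i' (j + N) * affDivSub q d β x a i' (j + e) * qFact q β (i' - j) *
        qFactInvSub q β (j + e) j * affDivSub q d β y a (j + N) j) =
      affDiv q d β N y a * (qFact q β e)⁻¹ * ∑ i ∈ range (M + 1),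
      affDiv q d β (M - i) y x * affDiv q d β i x a *
        (qFact q β N * gaussChoose q β (i + e) N) := by
    obtain ⟨L, rfl⟩ := Nat.exists_eq_add_of_le (by omega : j + e + (M + 1) ≤ K)
    rw [sum_range_add, sum_range_add, sum_eq_zero (s := range (j + e)),
      sum_eq_zero (s := range L), zero_add, add_zero, mul_sum]
    · refine sum_congr rfl fun i hi => ?_
      have hi' := mem_range.1 hi
      have e1 : qFactInvSub q β (j + e + i) (j + N) = qFactInvSub q β (i + e) N := by
        simp only [qFactInvSub]
        refine if_congr (by omega) ?_ rfl
        congr 2; omega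
      have e2 : j + e + i - j = i + e := by omega
      rw [affDivSub_of_le (by omega), affDivSub_of_le (by omega), affDivSub_of_le (by omega),
        qFactInvSub_of_le (by omega : j ≤ j + e), e1, e2, ← qFact_mul_qFactInvSub hB]
      rw [show j + e + M - (j + e + i) = M - i by omega, show j + e + i - (j + e) = i by omega,
        show j + N - j = N by omega, show j + e - j = e by omega]
      ring
    · intro i _
      rw [affDivSub_of_lt (N := j + e + M) (by omega)]; ring
    · intro i hi
      rw [affDivSub_of_lt (N := i) (mem_range.1 hi)]; ring
  -- The same convolution with M and N exchanged and e' in place of e; the summation index runs in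
  -- the opposite direction.
  have rhs : ∑ j' ∈ range K, (qFactInvSub q β (j + e + M) (j + N) *
      affDivSub q d β y a (j + e + M) (j + e) * qFact q β (j + e + M - j') *
        qFactInvSub q β (j + e) j' * affDivSub q d β x a (j + N) j') * affDivSub q d β y x j' j =
      affDiv q d β M y a * (qFact q β e')⁻¹ * ∑ i ∈ range (N + 1),
      affDiv q d β (N - i) y x * affDiv q d β i x a *
        (qFact q β M * gaussChoose q β (i + e') M) := by
    obtain ⟨L, rfl⟩ := Nat.exists_eq_add_of_le (by omega : j + (N + 1) ≤ K)
    rw [sum_range_add, sum_range_add, sum_eq_zero (s := range j),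
      sum_eq_zero (s := range L), zero_add, add_zero, mul_sum, ← sum_range_reflect]
    · refine sum_congr rfl fun i hi => ?_
      have hi' := mem_range.1 hi
      rw [show j + (N + 1 - 1 - i) = j + N - i by omega]
      have e1 : qFactInvSub q β (j + e) (j + N - i) = qFactInvSub q β (i + e') M := by
        simp only [qFactInvSub]
        refine if_congr (by omega) ?_ rfl
        congr 2; omega
      have e2 : j + e + M - (j + N - i) = i + e' := by omega
      rw [affDivSub_of_le (by omega), affDivSub_of_le (by omega), affDivSub_of_le (by omega),
        qFactInvSub_of_le (by omega : j + N ≤ j + e + M), e1, e2, ← qFact_mul_qFactInvSub hB]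
      rw [show j + e + M - (j + e) = M by omega, show j + N - (j + N - i) = i by omega,
        show j + N - i - j = N - i by omega, show j + e + M - (j + N) = e' by omega]
      ring
    · intro i _
      rw [affDivSub_of_lt (N := j + N) (by omega)]; ring
    · intro i hi
      rw [affDivSub_of_lt (N := i) (mem_range.1 hi)]; ring
  -- Since e + M = e' + N, the symmetric form is unchanged by (M, e) ↔ (N, e').
  rw [lhs, rhs, sum_affDiv_mul_gaussChoose hB, sum_affDiv_mul_gaussChoose hB, add_comm N M]
  refine sum_congr rfl fun l _ => ?_
  have e1 : e' + l - M = e + l - N := by omega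
  have e2 : qFactInvSub q β (e' + l) M = qFactInvSub q β (e + l) N := by
    simp only [qFactInvSub]
    refine if_congr (by omega) ?_ rfl
    congr 2
  rw [e1, e2]
  ring

end Exchange

/-! ### Symmetry of the two-variable functions by transfer matrices -/

section AffineBranching

open Finset

variable {k : Type*} [Field k] {q d β : k}

lemma nextPart_succ {n : ℕ} (v : Fin (n + 1) → ℕ) (i : Fin n) :
    nextPart v i.succ = nextPart (fun j => v j.succ) i := by
  simp only [nextPart, Fin.val_succ, Nat.add_lt_add_iff_right]
  rfl

lemma nextPart_zero {n : ℕ} (v : Fin (n + 2) → ℕ) : nextPart v 0 = v 1 := by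
  simp [nextPart]

lemma nextPart_zero_of_one (v : Fin 1 → ℕ) (i : Fin 1) : nextPart v i = 0 := by
  simp [nextPart]

/-- The common generalization of the one-variable interpolation `q`-Whittaker and elementary
functions to arbitrary affine progressions. -/
def affWeight {n : ℕ} (q d β : k) (A : ℕ → k) (x : k) (lam mu : Fin n → ℕ) : k :=
  ∏ r : Fin n, (affDivSub q d β x (A r) (lam r) (mu r) *
    (qFact q β (mu r - nextPart mu r) * qFactInvSub q β (mu r) (nextPart lam r)))

lemma affWeight_eq_ite {n : ℕ} (A : ℕ → k) (x : k) (lam mu : Fin n → ℕ) :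
    affWeight q d β A x lam mu = if Interlaces mu lam then
      ∏ r : Fin n, (affPoch q d (lam r - mu r) x (A r) * (qFact q β (mu r - nextPart mu r) /
        (qFact q β (lam r - mu r) * qFact q β (mu r - nextPart lam r)))) else 0 := by
  split_ifs with h
  · refine prod_congr rfl fun r _ => ?_
    rw [affDivSub_of_le (h r).2, qFactInvSub_of_le (h r).1, affDiv]
    ring
  · obtain ⟨r, hr⟩ := not_forall.1 h
    refine prod_eq_zero (mem_univ r) ?_
    rcases lt_or_ge (mu r) (nextPart lam r) with h1 | h1
    · rw [qFactInvSub_of_lt h1]; ring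
    · rw [affDivSub_of_lt (by omega)]; ring

/-- The two-step weight along the rows after a row with parts `i`, `s`. -/
def chainWeight (q d β x y : k) :
    (n : ℕ) → (ℕ → k) → ℕ → ℕ → (Fin n → ℕ) → (Fin n → ℕ) → (Fin n → ℕ) → k
  | 0, A, i, s, _, _, _ => exchangeWeight q d β x y (A 0) 0 s i 0
  | n + 1, A, i, s, lam, kap, mu =>
    exchangeWeight q d β x y (A 0) (lam 0) s i (mu 0) *
      chainWeight q d β x y n (fun r => A (r + 1)) (mu 0) (kap 0) (fun r => lam r.succ)
        (fun r => kap r.succ) (fun r => mu r.succ)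

/-- The sum of the two-step weights over intermediate partitions. -/
def chainSum (q d β x y : k) (K : ℕ) :
    (n : ℕ) → (ℕ → k) → ℕ → ℕ → (Fin n → ℕ) → (Fin n → ℕ) → k
  | 0, A, i, s, _, _ => exchangeWeight q d β x y (A 0) 0 s i 0
  | n + 1, A, i, s, lam, kap =>
    ∑ j ∈ range K, exchangeWeight q d β x y (A 0) (lam 0) s i j *
      chainSum q d β x y K n (fun r => A (r + 1)) j (kap 0) (fun r => lam r.succ)
        (fun r => kap r.succ)

/-- The exchange relation moves the factor from x to y down one row at a time, interchanging x and y
in the row it passes. Below the last row the outer part is 0, so there the factor can only be 1. -/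
lemma sum_affDivSub_mul_chainSum (hB : ∀ j, qNat q β (j + 1) ≠ 0) {K : ℕ} (x y : k) {n : ℕ}
    (A : ℕ → k) {i : ℕ} (hi : i < K) (s : ℕ) (lam kap : Fin n → ℕ) (hlam : ∀ r, lam r < K) :
    ∑ i' ∈ range K, affDivSub q d β y x i i' * chainSum q d β y x K n A i' s lam kap =
      chainSum q d β x y K n A i s lam kap := by
  induction n generalizing A i s with
  | zero =>
    simp only [chainSum]
    rw [sum_affDivSub_mul_exchangeWeight hB hi (by omega),
      sum_eq_single_of_mem 0 (mem_range.2 (by omega))]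
    · rw [affDivSub_of_le le_rfl]; simp
    · intro j _ hj
      rw [exchangeWeight, affDivSub_of_lt (N := 0) (M := j) (by omega)]; ring
  | succ n ih =>
    simp only [chainSum, mul_sum]
    rw [sum_comm]
    have e1 : ∀ j ∈ range K, ∑ i' ∈ range K, affDivSub q d β y x i i' *
        (exchangeWeight q d β y x (A 0) (lam 0) s i' j *
          chainSum q d β y x K n (fun r => A (r + 1)) j (kap 0) (fun r => lam r.succ)
            (fun r => kap r.succ)) =
        ∑ j' ∈ range K, exchangeWeight q d β x y (A 0) (lam 0) s i j' *
          (affDivSub q d β y x j' j *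
          chainSum q d β y x K n (fun r => A (r + 1)) j (kap 0) (fun r => lam r.succ)
            (fun r => kap r.succ)) := by
      intro j _
      simp only [← mul_assoc, ← sum_mul]
      rw [sum_affDivSub_mul_exchangeWeight hB hi (hlam 0)]
    rw [sum_congr rfl e1, sum_comm]
    refine sum_congr rfl fun j' hj' => ?_
    rw [← mul_sum, ih _ (mem_range.1 hj') _ _ _ fun r => hlam _]

/-- The functions `Fin n → ℕ` with values below `K`. -/
def natBox (n K : ℕ) : Finset (Fin n → ℕ) := Fintype.piFinset fun _ => range K

lemma mem_natBox {n K : ℕ} {v : Fin n → ℕ} : v ∈ natBox n K ↔ ∀ r, v r < K := by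
  simp [natBox]

lemma sum_natBox_succ {n K : ℕ} (g : (Fin (n + 1) → ℕ) → k) :
    ∑ v ∈ natBox (n + 1) K, g v = ∑ j ∈ range K, ∑ v ∈ natBox n K, g (Fin.cons j v) := by
  rw [← sum_product']
  refine sum_nbij' (fun v => (v 0, fun r => v r.succ)) (fun p => Fin.cons p.1 p.2) ?_ ?_ ?_ ?_ ?_
  · intro v hv
    rw [mem_natBox] at hv
    exact mem_product.2 ⟨mem_range.2 (hv 0), mem_natBox.2 fun r => hv _⟩
  · rintro ⟨j, v⟩ hp
    obtain ⟨h1, h2⟩ := mem_product.1 hp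
    rw [mem_natBox] at h2 ⊢
    intro r
    refine Fin.cases ?_ (fun r => ?_) r
    · simpa using h1
    · simpa using h2 r
  · intro v _
    exact Fin.cons_self_tail v
  · rintro ⟨j, v⟩ _
    simp
  · intro v _
    exact congrArg g (Fin.cons_self_tail v).symm

lemma sum_chainWeight (x y : k) (K : ℕ) {n : ℕ} (A : ℕ → k) (i s : ℕ) (lam kap : Fin n → ℕ) :
    ∑ mu ∈ natBox n K, chainWeight q d β x y n A i s lam kap mu =
      chainSum q d β x y K n A i s lam kap := by
  induction n generalizing A i s with
  | zero => simp [chainWeight, chainSum, natBox]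
  | succ n ih =>
    rw [sum_natBox_succ]
    simp only [chainWeight, chainSum, Fin.cons_zero, Fin.cons_succ]
    refine sum_congr rfl fun j _ => ?_
    rw [← mul_sum, ih]

/-- Regrouping makes each local weight depend on just two consecutive parts of `mu`. The shift of
parameters in the branching rule is essential: the y-factor of a row and the x-factor of the next
row share one parameter, as the exchange relation requires. -/
lemma affWeight_mul_affWeight {n : ℕ} (A : ℕ → k) (x y : k) (lam mu kap : Fin (n + 1) → ℕ) :
    affWeight q d β A x lam mu * affWeight q d β (fun r => A (r + 1)) y mu kap =
      (∏ r, qFact q β (kap r - nextPart kap r)) * (affDivSub q d β x (A 0) (lam 0) (mu 0) *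
        chainWeight q d β x y n (fun r => A (r + 1)) (mu 0) (kap 0) (fun r => lam r.succ)
          (fun r => kap r.succ) (fun r => mu r.succ)) := by
  unfold affWeight
  induction n generalizing A with
  | zero =>
    simp [chainWeight, nextPart_zero_of_one, exchangeWeight, affDivSub_of_le]
    ring
  | succ n ih =>
    rw [Fin.prod_univ_succ, Fin.prod_univ_succ (n := n + 1), Fin.prod_univ_succ (n := n + 1)]
    have h := ih (fun r => A (r + 1)) (fun r => lam r.succ) (fun r => mu r.succ)
      (fun r => kap r.succ)
    simp only [nextPart_succ, nextPart_zero, Fin.val_succ, Fin.val_zero, chainWeight,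
      exchangeWeight, zero_add, ← Fin.succ_zero_eq_one] at h ⊢
    linear_combination (affDivSub q d β x (A 0) (lam 0) (mu 0) *
      (qFact q β (mu 0 - mu (Fin.succ 0)) * qFactInvSub q β (mu 0) (lam (Fin.succ 0))) *
      (affDivSub q d β y (A 1) (mu 0) (kap 0) *
      (qFact q β (kap 0 - kap (Fin.succ 0)) * qFactInvSub q β (kap 0) (mu (Fin.succ 0))))) * h

/-- For fixed arguments the factors depend only on differences of indices, so this is a convolution,
and i ↦ N + M - i interchanges its factors. -/
lemma sum_affDivSub_mul_affDivSub_comm {N K : ℕ} (hN : N < K) (M : ℕ) (x y a b : k) :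
    ∑ i ∈ range K, affDivSub q d β x y N i * affDivSub q d β a b i M =
      ∑ i ∈ range K, affDivSub q d β a b N i * affDivSub q d β x y i M := by
  have main : ∀ x y a b : k, ∑ i ∈ range K, affDivSub q d β x y N i * affDivSub q d β a b i M =
      ∑ i ∈ Icc M N, affDiv q d β (N - i) x y * affDiv q d β (i - M) a b := by
    intro x y a b
    symm
    refine sum_subset_zero_on_sdiff (fun i hi => ?_) (fun i hi => ?_) fun i hi => ?_
    · have := Finset.mem_Icc.1 hi
      exact mem_range.2 (by omega)
    · have := (mem_sdiff.1 hi).2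
      rw [Finset.mem_Icc, not_and_or] at this
      rcases this with h | h
      · rw [affDivSub_of_lt (N := i) (by omega), mul_zero]
      · rw [affDivSub_of_lt (by omega), zero_mul]
    · have := Finset.mem_Icc.1 hi
      rw [affDivSub_of_le this.1, affDivSub_of_le this.2]
  rw [main, main]
  refine sum_nbij' (fun i => N + M - i) (fun i => N + M - i) ?_ ?_ ?_ ?_ ?_
  · intro i hi
    have := Finset.mem_Icc.1 hi
    exact Finset.mem_Icc.2 ⟨by omega, by omega⟩
  · intro i hi
    have := Finset.mem_Icc.1 hi
    exact Finset.mem_Icc.2 ⟨by omega, by omega⟩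
  · intro i hi
    have := Finset.mem_Icc.1 hi
    omega
  · intro i hi
    have := Finset.mem_Icc.1 hi
    omega
  · intro i hi
    have := Finset.mem_Icc.1 hi
    rw [show N - (N + M - i) = i - M by omega, show N + M - i - M = N - i by omega, mul_comm]

/-- The two-variable skew functions are symmetric. -/
lemma sum_affWeight_mul_affWeight_comm (hB : ∀ j, qNat q β (j + 1) ≠ 0) {n K : ℕ} (A : ℕ → k)
    (x y : k) (lam kap : Fin n → ℕ) (hlam : ∀ r, lam r < K) :
    ∑ mu ∈ natBox n K, affWeight q d β A x lam mu *
        affWeight q d β (fun r => A (r + 1)) y mu kap =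
      ∑ mu ∈ natBox n K, affWeight q d β A y lam mu *
        affWeight q d β (fun r => A (r + 1)) x mu kap := by
  cases n with
  | zero => simp [affWeight]
  | succ n =>
    have main : ∀ x y : k, ∑ mu ∈ natBox (n + 1) K, affWeight q d β A x lam mu *
        affWeight q d β (fun r => A (r + 1)) y mu kap =
        (∏ r, qFact q β (kap r - nextPart kap r)) * ∑ i ∈ range K,
          affDivSub q d β x (A 0) (lam 0) i * chainSum q d β x y K n (fun r => A (r + 1)) i
            (kap 0) (fun r => lam r.succ) (fun r => kap r.succ) := by
      intro x y
      simp only [affWeight_mul_affWeight]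
      rw [← mul_sum, sum_natBox_succ]
      simp only [Fin.cons_zero, Fin.cons_succ, ← mul_sum]
      congr 1
      refine sum_congr rfl fun i _ => ?_
      congr 1
      exact sum_chainWeight _ _ _ _ _ _ _ _
    rw [main, main]
    congr 1
    -- An operator from x to y is inserted in front of the chain, interchanging its variables.
    -- Commuted past the first factor and composed with it, it turns the x-factor of the first row
    -- into the y-factor.
    have e1 : ∀ i ∈ range K, affDivSub q d β x (A 0) (lam 0) i *
        chainSum q d β x y K n (fun r => A (r + 1)) i (kap 0) (fun r => lam r.succ)
          (fun r => kap r.succ) = ∑ i' ∈ range K, affDivSub q d β x (A 0) (lam 0) i *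
            (affDivSub q d β y x i i' * chainSum q d β y x K n (fun r => A (r + 1)) i' (kap 0)
              (fun r => lam r.succ) (fun r => kap r.succ)) := by
      intro i hi
      rw [← mul_sum, sum_affDivSub_mul_chainSum hB _ _ _ (mem_range.1 hi) _ _ _ fun r => hlam _]
    rw [sum_congr rfl e1, sum_comm]
    refine sum_congr rfl fun i' _ => ?_
    simp only [← mul_assoc, ← sum_mul]
    rw [sum_affDivSub_mul_affDivSub_comm (hlam 0), sum_affDivSub_mul_affDivSub hB (hlam 0)]

/-! ### Symmetry, vanishing and non-vanishing of the branching functions -/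

/-- The branching functions of the weights `affWeight`. -/
def affBranching {n : ℕ} (q d β : k) (m : ℕ) (x : Fin m → k) (A : ℕ → k) (lam nu : Fin n → ℕ) : k :=
  branching (affWeight q d β) m x A lam nu

lemma affBranching_succ {n K : ℕ} {m : ℕ} (x : Fin (m + 1) → k) (A : ℕ → k) {lam : Fin n → ℕ}
    (hlam : ∀ r, lam r < K) (nu : Fin n → ℕ) :
    affBranching q d β (m + 1) x A lam nu = ∑ mu ∈ natBox n K, affWeight q d β A (x 0) lam mu *
      affBranching q d β m (fun i => x i.succ) (fun i => A (i + 1)) mu nu := by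
  unfold affBranching
  rw [branching]
  refine sum_subset (fun mu hmu => mem_natBox.2 fun r => ?_) fun mu _ hmu => ?_
  · exact ((Finset.mem_Icc.1 hmu).2 r).trans_lt (hlam r)
  · rw [affWeight_eq_ite, if_neg, zero_mul]
    intro h
    exact hmu (Finset.mem_Icc.2 ⟨fun r => (h r).1, fun r => (h r).2⟩)

/-- A swap of the first two variables is the two-variable symmetry applied to the two outermost
branching steps; any other adjacent swap acts after the first variable has been split off. -/
lemma affBranching_comp_swap (hB : ∀ j, qNat q β (j + 1) ≠ 0) {n m : ℕ} (i : Fin m)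
    (x : Fin (m + 1) → k) (A : ℕ → k) (lam nu : Fin n → ℕ) :
    affBranching q d β (m + 1) (x ∘ Equiv.swap i.castSucc i.succ) A lam nu =
      affBranching q d β (m + 1) x A lam nu := by
  obtain ⟨K, hK⟩ : ∃ K, ∀ r, lam r < K :=
    ⟨∑ r, lam r + 1, fun r => Nat.lt_succ_of_le (single_le_sum (by simp) (mem_univ r))⟩
  induction m generalizing A lam with
  | zero => exact i.elim0
  | succ m ih =>
    refine Fin.cases ?_ (fun i => ?_) i
    · have expand : ∀ x : Fin (m + 2) → k, affBranching q d β (m + 2) x A lam nu =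
          ∑ kap ∈ natBox n K, (∑ mu ∈ natBox n K, affWeight q d β A (x 0) lam mu *
            affWeight q d β (fun i => A (i + 1)) (x 1) mu kap) *
            affBranching q d β m (fun i => x i.succ.succ) (fun i => A (i + 1 + 1)) kap nu := by
        intro x
        rw [affBranching_succ x A hK]
        simp only [sum_mul]
        rw [sum_comm]
        refine sum_congr rfl fun mu hmu => ?_
        rw [affBranching_succ _ _ (mem_natBox.1 hmu), mul_sum]
        refine sum_congr rfl fun kap _ => ?_
        rw [← mul_assoc, Fin.succ_zero_eq_one]
      rw [expand, expand]
      refine sum_congr rfl fun kap _ => ?_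
      congr 1
      rw [sum_affWeight_mul_affWeight_comm hB A (x 0) (x 1) _ _ hK]
      simp
    · rw [affBranching_succ _ _ hK, affBranching_succ _ _ hK]
      refine sum_congr rfl fun mu hmu => ?_
      have h0 : Equiv.swap (Fin.castSucc i.succ) i.succ.succ 0 = 0 :=
        Equiv.swap_apply_of_ne_of_ne (by simp [Fin.ext_iff]) (by simp [Fin.ext_iff])
      rw [Function.comp_apply, h0]
      congr 1
      rw [← ih i (fun j => x j.succ) _ _ (mem_natBox.1 hmu)]
      congr 1
      funext j
      simp only [Function.comp_apply]
      rw [← Fin.succ_castSucc, (Fin.succ_injective _).swap_apply]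

lemma affBranching_comp_perm (hB : ∀ j, qNat q β (j + 1) ≠ 0) {n m : ℕ} (σ : Equiv.Perm (Fin m))
    (x : Fin m → k) (A : ℕ → k) (lam nu : Fin n → ℕ) :
    affBranching q d β m (x ∘ σ) A lam nu = affBranching q d β m x A lam nu := by
  cases m with
  | zero => congr 1; funext i; exact i.elim0
  | succ m =>
    have hσ : σ ∈ Submonoid.closure
        (Set.range fun i : Fin m => Equiv.swap i.castSucc i.succ) := by
      rw [Equiv.Perm.mclosure_swap_castSucc_succ]; trivial
    induction hσ using Submonoid.closure_induction generalizing x with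
    | mem τ hτ =>
      obtain ⟨i, rfl⟩ := hτ
      exact affBranching_comp_swap hB i x A lam nu
    | one => rfl
    | mul σ τ _ _ hσ hτ =>
      rw [Equiv.Perm.coe_mul, ← Function.comp_assoc, hτ, hσ]

/-- Some summand `mu` is nonzero, and induction on the remaining variables gives mu_r ≤ s_{r+1}.
Interlacing then bounds every part of `lam` after the first. For the first, x_0 = T^(s_0 - s_1) a_0
must not be a root of the factorial of order lam_0 - mu_0, so lam_0 - mu_0 ≤ s_0 - s_1. -/
lemma affBranching_vanishing {n m : ℕ} (x : Fin m → k) (A : ℕ → k) (lam : Fin n → ℕ) (s : ℕ → ℕ)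
    (hs : Antitone s) (hsm : s m = 0)
    (hx : ∀ i : Fin m, x i = (affMap q d)^[s i - s (i + 1)] (A i))
    (h : affBranching q d β m x A lam 0 ≠ 0) (r : Fin n) : lam r ≤ s r := by
  induction m generalizing A lam s r with
  | zero =>
    have : lam = 0 := by
      by_contra hne
      exact h (by simp [affBranching, branching, hne])
    simp [this]
  | succ m ih =>
    obtain ⟨mu, hmu, hne⟩ := exists_ne_zero_of_sum_ne_zero h
    have hw := left_ne_zero_of_mul hne
    have hmu' : ∀ r, mu r ≤ s (r + 1) :=
      ih (fun i => x i.succ) (fun i => A (i + 1)) mu (fun i => s (i + 1))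
        (fun a b hab => hs (by omega)) hsm (fun i => hx i.succ) (right_ne_zero_of_mul hne)
    have hmem := Finset.mem_Icc.1 hmu
    rcases Nat.eq_zero_or_pos (r : ℕ) with h0 | h0
    · have hfac := (prod_ne_zero_iff.1 hw) r (mem_univ r)
      have hd := left_ne_zero_of_mul hfac
      rw [affDivSub_of_le (hmem.2 r), affDiv, hx 0] at hd
      have hd' := (div_ne_zero_iff.1 hd).1
      by_contra hlt
      refine hd' (prod_eq_zero (i := s 0 - s 1) (mem_range.2 ?_) ?_)
      · have h1 := hmu' r
        have h2 : s 1 ≤ s 0 := hs (by omega)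
        rw [h0] at h1 hlt
        simp only [zero_add] at h1
        omega
      · rw [h0]; simp
    · have h1 := hmem.1 ⟨r - 1, by omega⟩
      have h2 := hmu' ⟨r - 1, by omega⟩
      have h3 : nextPart lam ⟨r - 1, by omega⟩ = lam r := by
        unfold nextPart
        rw [dif_pos (by simp; omega)]
        congr 1
        ext
        simp; omega
      rw [h3] at h1
      simp only [show (r : ℕ) - 1 + 1 = r by omega] at h2
      exact h1.trans h2

/-- Only one chain of partitions contributes: the vanishing lemma gives mu_r ≤ lam_{r+1} and
interlacing gives the converse, so each step removes the first row. Owing to the shift of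
parameters, x_i meets only the a_r with i ≤ r. -/
lemma affBranching_ne_zero (hB : ∀ j, qNat q β (j + 1) ≠ 0) {n m : ℕ} (x : Fin m → k) (A : ℕ → k)
    (lam : Fin n → ℕ) (s : ℕ → ℕ) (hs : Antitone s) (hsm : s m = 0) (hsn : s n = 0)
    (hlam : ∀ r : Fin n, lam r = s r)
    (hx : ∀ i : Fin m, x i = (affMap q d)^[s i - s (i + 1)] (A i))
    (hne : ∀ i r j, i ≤ r → j < s r - s (r + 1) →
      (affMap q d)^[s i - s (i + 1)] (A i) ≠ (affMap q d)^[j] (A r)) :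
    affBranching q d β m x A lam 0 ≠ 0 := by
  induction m generalizing A lam s with
  | zero =>
    have : lam = 0 := by
      funext r
      have := hs (Nat.zero_le r)
      simp only [hsm] at this
      rw [hlam r, Pi.zero_apply]; omega
    simp [affBranching, branching, this]
  | succ m ih =>
    have hnext : ∀ r : Fin n, nextPart lam r = s (r + 1) := by
      intro r
      unfold nextPart
      split_ifs with h
      · exact hlam _
      · have := hs (by omega : n ≤ r + 1)
        omega
    have hle : nextPart lam ≤ lam := fun r => by
      rw [hnext, hlam]; exact hs (Nat.le_succ _)
    have hs' : Antitone fun i => s (i + 1) := fun a b hab => hs (by omega)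
    unfold affBranching
    rw [branching, sum_eq_single_of_mem (nextPart lam) (Finset.mem_Icc.2 ⟨le_rfl, hle⟩)]
    · refine mul_ne_zero ?_ (ih (fun i => x i.succ) (fun i => A (i + 1)) (nextPart lam)
        (fun i => s (i + 1)) hs' hsm (by have := hs (Nat.le_succ n); rw [hsn] at this; exact Nat.le_zero.1 this)
        hnext (fun i => hx i.succ) fun i r j hir hj => hne (i + 1) (r + 1) j (by omega) hj)
      refine prod_ne_zero_iff.2 fun r _ => ?_
      rw [affDivSub_of_le (hle r), qFactInvSub_of_le le_rfl, affDiv]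
      refine mul_ne_zero (div_ne_zero (prod_ne_zero_iff.2 fun j hj => ?_) (qFact_ne_zero hB _))
        (mul_ne_zero (qFact_ne_zero hB _) (inv_ne_zero (qFact_ne_zero hB _)))
      rw [sub_ne_zero, hx 0]
      refine hne 0 r j (Nat.zero_le _) ?_
      rw [← hnext, ← hlam]
      exact mem_range.1 hj
    · intro mu hmu hmne
      rw [mul_eq_zero, or_iff_not_imp_right]
      intro h
      exfalso
      refine hmne (le_antisymm (fun r => ?_) (Finset.mem_Icc.1 hmu).1)
      rw [hnext]
      exact affBranching_vanishing (fun i => x i.succ) (fun i => A (i + 1)) mu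
        (fun i => s (i + 1)) hs' hsm (fun i => hx i.succ) h r

end AffineBranching

/-! ### Uniqueness of interpolation polynomials by a dimension count -/

section Uniqueness

open Finset MvPolynomial

variable {k : Type*} [Field k] {n : ℕ}

lemma finite_ptn_size_le (n N : ℕ) : Finite {mu : Ptn n // mu.size ≤ N} := by
  refine Finite.of_injective (β := Fin n → Fin (N + 1)) (fun mu i => ⟨mu.1.1 i, ?_⟩) ?_
  · exact Nat.lt_succ_of_le ((single_le_sum (f := mu.1.1) (by simp) (mem_univ i)).trans mu.2)
  · intro mu nu h
    ext i
    exact congrArg Fin.val (congrFun h i)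

lemma exists_antitone_comp_perm (e : Fin n → ℕ) : ∃ σ : Equiv.Perm (Fin n), Antitone (e ∘ σ) := by
  refine ⟨Fin.revPerm.trans (Tuple.sort e), ?_⟩
  have h := Tuple.monotone_sort e
  intro i j hij
  exact h (Fin.rev_le_rev.2 hij)

/-- A symmetric polynomial is determined by its coefficients at partitions. -/
lemma eq_zero_of_isSymmetric_of_coeff {F : MvPolynomial (Fin n) k} (hF : F.IsSymmetric) {N : ℕ}
    (hdeg : F.totalDegree ≤ N)
    (h : ∀ mu : Ptn n, mu.size ≤ N → coeff (Finsupp.equivFunOnFinite.symm mu.1) F = 0) : F = 0 := by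
  ext e
  rw [coeff_zero]
  rcases lt_or_ge N (∑ i, e i) with hN | hN
  · apply coeff_eq_zero_of_totalDegree_lt
    refine hdeg.trans_lt (hN.trans_le (le_of_eq ?_))
    refine (sum_subset (subset_univ _) fun i _ hi => ?_).symm
    simpa using hi
  · obtain ⟨σ, hσ⟩ := exists_antitone_comp_perm e
    have h1 := coeff_rename_mapDomain σ.symm σ.symm.injective F e
    rw [hF σ.symm] at h1
    rw [← h1]
    have h2 : Finsupp.mapDomain σ.symm e = Finsupp.equivFunOnFinite.symm (e ∘ σ) := by
      ext i
      simp
    rw [h2]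
    refine h ⟨e ∘ σ, hσ⟩ ?_
    unfold Ptn.size
    simp only [Function.comp_apply]
    rwa [Equiv.sum_comp σ fun i => e i]

lemma sum_filter_smul_single_apply {S : Type*} [Fintype S] [DecidableEq S] (p : S → Prop)
    [DecidablePred p] (g : S → k) (nu : S) :
    (∑ mu with p mu, g mu • (Pi.single mu 1 : S → k)) nu = if p nu then g nu else 0 := by
  rw [Finset.sum_apply, sum_filter, sum_eq_single nu]
  · simp
  · intro mu _ hmu
    simp [hmu.symm]
  · simp

/-- The space of symmetric polynomials of bounded degree. -/
def symmetricDegreeLE (k : Type*) [Field k] (n N : ℕ) : Submodule k (MvPolynomial (Fin n) k) where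
  carrier := {F | F.IsSymmetric ∧ F.totalDegree ≤ N}
  add_mem' hF hG := ⟨hF.1.add hG.1, (totalDegree_add _ _).trans (max_le hF.2 hG.2)⟩
  zero_mem' := ⟨IsSymmetric.zero, by simp⟩
  smul_mem' c _ hF := ⟨hF.1.smul c, (totalDegree_smul_le _ _).trans hF.2⟩

/-- For a non-degenerate grid, a symmetric polynomial of degree at most `N` is determined by its
values at the points with indices of size at most `N`. -/
lemma IsNondegenerate.eq_zero {Om : Ptn n → Fin n → k} (hOm : IsNondegenerate Om)
    {F : MvPolynomial (Fin n) k} (hF : F.IsSymmetric) {N : ℕ} (hdeg : F.totalDegree ≤ N)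
    (h : ∀ mu : Ptn n, mu.size ≤ N → eval (Om mu) F = 0) : F = 0 := by
  classical
  let S := {mu : Ptn n // mu.size ≤ N}
  have : Finite S := finite_ptn_size_le n N
  have : Fintype S := Fintype.ofFinite S
  let V := symmetricDegreeLE k n N
  -- Coefficients at partitions embed V into the functions on S, so dim V ≤ |S|. Evaluation at grid
  -- points maps V onto the same space, hence is bijective.
  let co : V →ₗ[k] (S → k) := LinearMap.pi fun mu =>
    (lcoeff k (Finsupp.equivFunOnFinite.symm mu.1.1)).comp V.subtype
  let ev : V →ₗ[k] (S → k) := LinearMap.pi fun mu =>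
    (aeval (Om mu.1) : MvPolynomial (Fin n) k →ₐ[k] k).toLinearMap.comp V.subtype
  have ev_apply : ∀ (G : V) (mu : S), ev G mu = eval (Om mu.1) G.1 := fun G mu => by
    simp [ev, aeval_eq_eval]
  have co_inj : Function.Injective co := by
    rw [← LinearMap.ker_eq_bot, LinearMap.ker_eq_bot']
    intro G hG
    exact Subtype.ext (eq_zero_of_isSymmetric_of_coeff G.2.1 G.2.2 fun mu hmu =>
      congrFun hG ⟨mu, hmu⟩)
  have hfin : FiniteDimensional k V := FiniteDimensional.of_injective co co_inj
  -- Downward induction on the size: the values of an interpolation polynomial are triangular, and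
  -- the unwanted ones sit at larger indices that are already in the range.
  have ev_single : ∀ (r : ℕ) (lam : S), N - lam.1.size ≤ r →
      (Pi.single lam 1 : S → k) ∈ LinearMap.range ev := by
    intro r
    induction r using Nat.strong_induction_on with
    | _ r ih =>
      intro lam hr
      obtain ⟨G, hG⟩ := hOm lam.1
      let G' : V := ⟨G, hG.symmetric, hG.degree_le.trans lam.2⟩
      have hsum : (Pi.single lam 1 : S → k) = (eval (Om lam.1) G)⁻¹ • (ev G' -
          ∑ mu : S with lam.1.size < mu.1.size,
            eval (Om mu.1) G • (Pi.single mu 1 : S → k)) := by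
        funext nu
        rw [Pi.smul_apply, Pi.sub_apply, sum_filter_smul_single_apply
          (fun mu : S => lam.1.size < mu.1.size) (fun mu => eval (Om mu.1) G), ev_apply, smul_eq_mul]
        by_cases h1 : nu = lam
        · subst h1
          simp [G', hG.eval_ne_zero]
        · rw [Pi.single_eq_of_ne h1]
          by_cases h2 : lam.1.size < nu.1.size
          · rw [if_pos h2]; simp [G']
          · rw [if_neg h2, show (G' : MvPolynomial (Fin n) k) = G from rfl, hG.eval_eq_zero nu.1 (not_lt.1 h2) fun h => h1 (Subtype.ext h)]; simp
      rw [hsum]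
      refine Submodule.smul_mem _ _ (Submodule.sub_mem _ ⟨G', rfl⟩
        (Submodule.sum_mem _ fun mu hmu => Submodule.smul_mem _ _ ?_))
      have h1 := (mem_filter.1 hmu).2
      have h2 := mu.2
      exact ih (N - mu.1.size) (by omega) mu le_rfl
  have ev_surj : Function.Surjective ev := by
    rw [← LinearMap.range_eq_top, eq_top_iff]
    intro g _
    rw [pi_eq_sum_univ' g]
    refine Submodule.sum_mem _ fun mu _ => ?_
    have := Submodule.smul_mem _ (g mu) (ev_single N mu (by omega))
    convert this using 2
  have hrank : Module.finrank k V = Module.finrank k (S → k) :=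
    le_antisymm (LinearMap.finrank_le_finrank_of_injective co_inj)
      (LinearMap.finrank_le_finrank_of_surjective ev_surj)
  have ev_inj := (LinearMap.injective_iff_surjective_of_finrank_eq_finrank hrank).2 ev_surj
  have h0 : (⟨F, hF, hdeg⟩ : V) = 0 := by
    apply ev_inj
    rw [map_zero]
    funext mu
    rw [ev_apply]
    exact h mu.1 mu.2
  exact congrArg Subtype.val h0

lemma IsInterpolation.C_mul {Om : Ptn n → Fin n → k} {lam : Ptn n} {F : MvPolynomial (Fin n) k}
    (hF : IsInterpolation Om lam F) {s : k} (hs : s ≠ 0) : IsInterpolation Om lam (C s * F) where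
  symmetric := (IsSymmetric.C s).mul hF.symmetric
  degree_le := by
    refine (totalDegree_mul _ _).trans ?_
    rw [totalDegree_C, zero_add]
    exact hF.degree_le
  eval_eq_zero mu h1 h2 := by rw [map_mul, hF.eval_eq_zero mu h1 h2, mul_zero]
  eval_ne_zero := by
    rw [map_mul, eval_C]
    exact mul_ne_zero hs hF.eval_ne_zero

/-- Interpolation polynomials of a non-degenerate grid are unique up to scalars. -/
lemma IsNondegenerate.isInterpolation_iff {Om : Ptn n → Fin n → k} (hOm : IsNondegenerate Om)
    {lam : Ptn n} {G : MvPolynomial (Fin n) k} (hG : IsInterpolation Om lam G)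
    (F : MvPolynomial (Fin n) k) : IsInterpolation Om lam F ↔ ∃ s : k, s ≠ 0 ∧ F = C s * G := by
  refine ⟨fun hF => ?_, ?_⟩
  · refine ⟨eval (Om lam) F / eval (Om lam) G, div_ne_zero hF.eval_ne_zero hG.eval_ne_zero, ?_⟩
    rw [← sub_eq_zero]
    have hG' := hG.C_mul (div_ne_zero hF.eval_ne_zero hG.eval_ne_zero)
    refine hOm.eq_zero (hF.symmetric.sub hG'.symmetric)
      ((totalDegree_sub _ _).trans (max_le hF.degree_le hG'.degree_le)) fun mu hmu => ?_
    rw [map_sub]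
    by_cases h : mu = lam
    · subst h
      rw [map_mul, eval_C, div_mul_cancel₀ _ hG.eval_ne_zero, sub_self]
    · rw [hF.eval_eq_zero mu hmu h, hG'.eval_eq_zero mu hmu h, sub_self]
  · rintro ⟨s, hs, rfl⟩
    exact hG.C_mul hs

end Uniqueness

/-! ### Interpolation polynomials for grids of affine progressions -/

section AffineInterpolation

open Finset MvPolynomial

variable {k : Type*} [Field k] {n : ℕ}

/-- The weight `affWeight` with argument in a `k`-algebra. -/
def affWeightAlg {R : Type*} [CommRing R] [Algebra k R] (q d β : k) (A : ℕ → k) (x : R)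
    (lam mu : Fin n → ℕ) : R :=
  if Interlaces mu lam then
    ∏ r : Fin n, ((∏ j ∈ range (lam r - mu r), (x - algebraMap k R ((affMap q d)^[j] (A r)))) *
      algebraMap k R (qFact q β (mu r - nextPart mu r) /
        (qFact q β (lam r - mu r) * qFact q β (mu r - nextPart lam r))))
  else 0

/-- The interpolation polynomial for a grid of affine progressions. -/
noncomputable def affInterp (q d β : k) (A : ℕ → k) (lam : Ptn n) : MvPolynomial (Fin n) k :=
  branching (affWeightAlg q d β) n X A lam.1 0

variable {q d β : k}

lemma map_branching {K R S : Type*} [CommRing R] [CommRing S] (φ : R →+* S)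
    (w : (ℕ → K) → R → (Fin n → ℕ) → (Fin n → ℕ) → R)
    (w' : (ℕ → K) → S → (Fin n → ℕ) → (Fin n → ℕ) → S)
    (hw : ∀ A x lam mu, φ (w A x lam mu) = w' A (φ x) lam mu)
    (m : ℕ) (x : Fin m → R) (A : ℕ → K) (lam nu : Fin n → ℕ) :
    φ (branching w m x A lam nu) = branching w' m (fun i => φ (x i)) A lam nu := by
  induction m generalizing A lam with
  | zero => simp only [branching]; split_ifs <;> simp
  | succ m ih => simp only [branching, map_sum, map_mul, hw, ih]

lemma branching_reparam {K R : Type*} [CommRing R] (g : R → R) (h : K → K)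
    (w w' : (ℕ → K) → R → (Fin n → ℕ) → (Fin n → ℕ) → R)
    (hw : ∀ A x lam mu, w A (g x) lam mu = w' (fun i => h (A i)) x lam mu)
    (m : ℕ) (x : Fin m → R) (A : ℕ → K) (lam nu : Fin n → ℕ) :
    branching w m (fun i => g (x i)) A lam nu = branching w' m x (fun i => h (A i)) lam nu := by
  induction m generalizing A lam with
  | zero => simp only [branching]
  | succ m ih => simp only [branching, hw, ih]

lemma affWeightAlg_self (A : ℕ → k) (x : k) (lam mu : Fin n → ℕ) :
    affWeightAlg q d β A x lam mu = affWeight q d β A x lam mu := by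
  rw [affWeight_eq_ite]; rfl

lemma map_affWeightAlg {R S : Type*} [CommRing R] [Algebra k R] [CommRing S] [Algebra k S]
    (φ : R →ₐ[k] S) (A : ℕ → k) (x : R) (lam mu : Fin n → ℕ) :
    φ (affWeightAlg q d β A x lam mu) = affWeightAlg q d β A (φ x) lam mu := by
  unfold affWeightAlg
  split_ifs
  · simp only [map_prod, map_mul, map_sub, AlgHom.commutes]
  · exact map_zero φ

lemma eval_affInterp (A : ℕ → k) (lam : Ptn n) (x : Fin n → k) :
    eval x (affInterp q d β A lam) = affBranching q d β n x A lam.1 0 := by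
  rw [affInterp, affBranching, map_branching (eval x) _ (affWeight q d β)]
  · simp
  · intro A y lam mu
    rw [← affWeightAlg_self, ← aeval_eq_eval]
    exact map_affWeightAlg _ _ _ _ _

/-- Over an infinite field symmetry may be checked on values, where it is the symmetry of the
branching functions. -/
lemma affInterp_isSymmetric [Infinite k] (hB : ∀ j, qNat q β (j + 1) ≠ 0) (A : ℕ → k)
    (lam : Ptn n) : (affInterp q d β A lam).IsSymmetric := by
  intro σ
  refine MvPolynomial.funext fun x => ?_
  rw [eval_rename, eval_affInterp, eval_affInterp, affBranching_comp_perm hB]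

lemma totalDegree_affWeightAlg_le {σ : Type*} (A : ℕ → k) (i : σ) (lam mu : Fin n → ℕ) :
    (affWeightAlg q d β A (X i : MvPolynomial σ k) lam mu).totalDegree ≤ ∑ r, (lam r - mu r) := by
  unfold affWeightAlg
  split_ifs
  · refine (totalDegree_finsetProd _ _).trans (sum_le_sum fun r _ => ?_)
    refine (totalDegree_mul _ _).trans ?_
    rw [algebraMap_eq, totalDegree_C, add_zero]
    refine (totalDegree_finsetProd _ _).trans ?_
    refine (sum_le_card_nsmul _ _ 1 fun j _ => ?_).trans (by simp)
    refine (totalDegree_sub _ _).trans ?_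
    rw [totalDegree_X, totalDegree_C]; simp
  · simp

lemma totalDegree_branching_affWeightAlg_le {σ : Type*} (m : ℕ) (x : Fin m → σ) (A : ℕ → k)
    (lam : Fin n → ℕ) :
    (branching (affWeightAlg q d β) m (fun i => (X (x i) : MvPolynomial σ k)) A lam 0).totalDegree ≤
      ∑ r, lam r := by
  induction m generalizing A lam with
  | zero => simp only [branching]; split_ifs <;> simp
  | succ m ih =>
    rw [branching]
    refine totalDegree_finsetSum_le fun mu hmu => ?_
    refine (totalDegree_mul _ _).trans ((add_le_add (totalDegree_affWeightAlg_le _ _ _ _)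
      (ih (fun i => x i.succ) _ mu)).trans ?_)
    rw [← sum_add_distrib]
    refine sum_le_sum fun r _ => ?_
    have : mu r ≤ lam r := (Finset.mem_Icc.1 hmu).2 r
    omega

lemma totalDegree_affInterp_le (A : ℕ → k) (lam : Ptn n) :
    (affInterp q d β A lam).totalDegree ≤ lam.size :=
  totalDegree_branching_affWeightAlg_le n id A lam.1

/-- A partition as a sequence, extended by zeros. -/
def Ptn.seq (lam : Ptn n) (i : ℕ) : ℕ := if h : i < n then lam.1 ⟨i, h⟩ else 0

lemma Ptn.seq_val (lam : Ptn n) (i : Fin n) : lam.seq i = lam.1 i := by simp [Ptn.seq]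

lemma Ptn.seq_antitone (lam : Ptn n) : Antitone lam.seq := by
  intro i j hij
  unfold Ptn.seq
  split_ifs with h1 h2
  · exact lam.2 hij
  · omega
  · omega
  · omega

lemma Ptn.seq_of_ge (lam : Ptn n) {i : ℕ} (h : n ≤ i) : lam.seq i = 0 := dif_neg (by omega)

lemma Ptn.seq_succ (lam : Ptn n) (i : Fin n) : lam.seq (i + 1) = nextPart lam.1 i := rfl

/-- `Om` consists of progressions of the affine map `affMap q d` starting at `A`. -/
def IsAffineGrid (q d : k) (A : ℕ → k) (Om : Ptn n → Fin n → k) : Prop :=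
  ∀ lam i, Om lam i = (affMap q d)^[lam.1 i - nextPart lam.1 i] (A i)

lemma IsAffineGrid.eval_affInterp_eq_zero {A : ℕ → k} {Om : Ptn n → Fin n → k}
    (hOm : IsAffineGrid q d A Om) {lam mu : Ptn n} (h : ¬ lam ≤ mu) :
    eval (Om mu) (affInterp q d β A lam) = 0 := by
  by_contra hne
  rw [eval_affInterp] at hne
  refine h fun r => ?_
  have := affBranching_vanishing (Om mu) A lam.1 mu.seq mu.seq_antitone (mu.seq_of_ge le_rfl)
    (fun i => by rw [hOm, Ptn.seq_succ, Ptn.seq_val]) hne r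
  rwa [Ptn.seq_val] at this

lemma IsAffineGrid.eval_affInterp_ne_zero {A : ℕ → k} {Om : Ptn n → Fin n → k}
    (hOm : IsAffineGrid q d A Om) (hB : ∀ j, qNat q β (j + 1) ≠ 0) {lam : Ptn n}
    (hne : ∀ (i r : Fin n) (j : ℕ), i ≤ r → j < lam.1 r - nextPart lam.1 r →
      (affMap q d)^[lam.1 i - nextPart lam.1 i] (A i) ≠ (affMap q d)^[j] (A r)) :
    eval (Om lam) (affInterp q d β A lam) ≠ 0 := by
  rw [eval_affInterp]
  refine affBranching_ne_zero hB (Om lam) A lam.1 lam.seq lam.seq_antitone (lam.seq_of_ge le_rfl)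
    (lam.seq_of_ge le_rfl) (fun r => (lam.seq_val r).symm)
    (fun i => by rw [hOm, Ptn.seq_succ, Ptn.seq_val]) fun i r j hir hj => ?_
  rcases lt_or_ge r n with hr | hr
  · have hi : i < n := by omega
    have h1 := hne ⟨i, hi⟩ ⟨r, hr⟩ j hir
    rw [← Ptn.seq_succ, ← Ptn.seq_val, ← Ptn.seq_succ, ← Ptn.seq_val] at h1
    exact h1 hj
  · rw [lam.seq_of_ge hr] at hj
    omega

lemma not_le_of_size_le {lam mu : Ptn n} (h : mu.size ≤ lam.size) (hne : mu ≠ lam) :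
    ¬ lam ≤ mu := by
  intro hle
  refine hne (Subtype.ext (funext fun i => ?_))
  exact (((sum_eq_sum_iff_of_le fun i _ => hle i).1
    (le_antisymm (sum_le_sum fun i _ => hle i) h)) i (mem_univ i)).symm

/-- The progressions of `affMap q d` starting at `A 0, …, A (n - 1)` are injective and disjoint. -/
def AffineSeparated (q d : k) (n : ℕ) (A : ℕ → k) : Prop :=
  ∀ (i r : Fin n) (e j : ℕ), (i ≠ r ∨ e ≠ j) →
    (affMap q d)^[e] (A i) ≠ (affMap q d)^[j] (A r)

lemma IsAffineGrid.isInterpolation_affInterp [Infinite k] {A : ℕ → k} {Om : Ptn n → Fin n → k}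
    (hOm : IsAffineGrid q d A Om) (hB : ∀ j, qNat q β (j + 1) ≠ 0)
    (hA : AffineSeparated q d n A) (lam : Ptn n) :
    IsInterpolation Om lam (affInterp q d β A lam) where
  symmetric := affInterp_isSymmetric hB A lam
  degree_le := totalDegree_affInterp_le A lam
  eval_eq_zero _ h1 h2 := hOm.eval_affInterp_eq_zero (not_le_of_size_le h1 h2)
  eval_ne_zero := hOm.eval_affInterp_ne_zero hB fun i r j _ hj => hA i r _ _ (by
    by_cases h : i = r
    · subst h
      right; omega
    · exact Or.inl h)

lemma IsAffineGrid.isPerfect [Infinite k] {A : ℕ → k} {Om : Ptn n → Fin n → k}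
    (hOm : IsAffineGrid q d A Om) (hB : ∀ j, qNat q β (j + 1) ≠ 0)
    (hA : AffineSeparated q d n A) : IsPerfect Om := by
  have hnd : IsNondegenerate Om := fun lam => ⟨_, hOm.isInterpolation_affInterp hB hA lam⟩
  refine ⟨hnd, fun lam F hF mu hmu => ?_⟩
  obtain ⟨s, _, rfl⟩ :=
    (hnd.isInterpolation_iff (hOm.isInterpolation_affInterp hB hA lam) F).1 hF
  rw [map_mul, hOm.eval_affInterp_eq_zero hmu, mul_zero]

lemma IsAffineGrid.isInterpolation_iff [Infinite k] {A : ℕ → k} {Om : Ptn n → Fin n → k}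
    (hOm : IsAffineGrid q d A Om) (hB : ∀ j, qNat q β (j + 1) ≠ 0)
    (hA : AffineSeparated q d n A) (lam : Ptn n) (F : MvPolynomial (Fin n) k) :
    IsInterpolation Om lam F ↔ ∃ s : k, s ≠ 0 ∧ F = C s * affInterp q d β A lam :=
  (hOm.isPerfect hB hA).1.isInterpolation_iff (hOm.isInterpolation_affInterp hB hA lam) F

/-! ### Specialization to geometric and arithmetic progressions -/

lemma affMap_geometric_iterate (q c a : k) (j : ℕ) :
    (affMap q (c * (1 - q)))^[j] (a + c) = a * q ^ j + c := by
  induction j with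
  | zero => simp
  | succ j ih =>
    rw [Function.iterate_succ_apply', ih, affMap]; ring

lemma affMap_arithmetic_iterate (d a : k) (j : ℕ) : (affMap 1 d)^[j] a = a + j * d := by
  induction j with
  | zero => simp
  | succ j ih =>
    rw [Function.iterate_succ_apply', ih, affMap]; push_cast; ring

/-- The factor β serves to match normalizations: β = 1 - q produces (q; q)_N, while q = β = 1
produces ordinary factorials. -/
lemma qNat_one_sub (q : k) (j : ℕ) : qNat q (1 - q) j = 1 - q ^ j := mul_neg_geom_sum q j

lemma qFact_one_sub (q : k) (N : ℕ) : qFact q (1 - q) N = qqPoch q N :=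
  prod_congr rfl fun j _ => qNat_one_sub q (j + 1)

lemma qNat_one_one (j : ℕ) : qNat (1 : k) 1 j = j := by simp [qNat]

lemma qFact_one_one (N : ℕ) : qFact (1 : k) 1 N = N.factorial := by
  unfold qFact
  rw [← prod_range_add_one_eq_factorial, Nat.cast_prod]
  exact prod_congr rfl fun j _ => qNat_one_one (j + 1)

/-- The constant c is the fixed point of T, so (x - c) - a q^j = x - T^j(a + c). -/
lemma qWhittakerInterp_eq_affInterp (q c : k) (A : ℕ → k) (lam : Ptn n) :
    qWhittakerInterp q A (fun i => X i - C c) lam =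
      affInterp q (c * (1 - q)) (1 - q) (fun i => A i + c) lam := by
  unfold qWhittakerInterp affInterp
  refine branching_reparam (fun x => x - C c) (fun a => a + c) _ _ ?_ n X A lam.1 0
  intro A x lam mu
  unfold qWhittakerOne affWeightAlg
  simp only [affMap_geometric_iterate, qFact_one_sub, algebraMap_eq, C_add, ← sub_sub]
  simp only [sub_right_comm]

lemma elementaryInterp_eq_affInterp (d : k) (A : ℕ → k) (lam : Ptn n) :
    elementaryInterp d A (fun i => X i) lam = affInterp 1 d 1 A lam := by
  unfold elementaryInterp affInterp
  refine branching_reparam (fun x => x) (fun a => a) _ _ ?_ n X A lam.1 0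
  intro A x lam mu
  unfold elementaryOne affWeightAlg
  simp only [affMap_arithmetic_iterate, qFact_one_one]

lemma IsGeometricType.affineSeparated {f : Fin n → ℕ → k} {c q : k} {a : Fin n → k}
    (h : IsGeometricType f c q a) {A : ℕ → k} (hA : ∀ i : Fin n, A i = a i) :
    AffineSeparated q (c * (1 - q)) n (fun i => A i + c) := by
  intro i r e j hne heq
  simp only [affMap_geometric_iterate, hA, add_left_inj] at heq
  by_cases hir : i = r
  · subst hir
    have hej : e ≠ j := by simpa using hne
    have h1 := mul_left_cancel₀ (h.a_ne_zero i) heq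
    have key : ∀ u v : ℕ, u < v → q ^ u ≠ q ^ v := by
      intro u v huv he
      obtain ⟨w, rfl⟩ := Nat.exists_eq_add_of_lt huv
      rw [add_assoc, pow_add] at he
      exact h.not_root_of_unity (w + 1) (by omega)
        (mul_left_cancel₀ (pow_ne_zero u h.q_ne_zero) (by rw [← he, mul_one]))
    rcases lt_or_gt_of_ne hej with h2 | h2
    · exact key _ _ h2 h1
    · exact key _ _ h2 h1.symm
  · refine h.ratio_ne i r hir ((j : ℤ) - e) ?_
    rw [zpow_sub₀ h.q_ne_zero, zpow_natCast, zpow_natCast]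
    have := h.a_ne_zero r
    have := pow_ne_zero e h.q_ne_zero
    field_simp
    linear_combination heq

lemma IsArithmeticType.affineSeparated [CharZero k] {f : Fin n → ℕ → k} {d : k} {c : Fin n → k}
    (h : IsArithmeticType f d c) {A : ℕ → k} (hA : ∀ i : Fin n, A i = c i) :
    AffineSeparated 1 d n A := by
  intro i r e j hne heq
  simp only [affMap_arithmetic_iterate, hA] at heq
  by_cases hir : i = r
  · subst hir
    have hej : e ≠ j := by simpa using hne
    have h1 := mul_right_cancel₀ h.d_ne_zero (add_left_cancel heq)
    exact hej (Nat.cast_injective h1)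
  · refine h.diff_ne i r hir ((j : ℤ) - e) ?_
    push_cast
    linear_combination heq

lemma IsGeometricType.qNat_ne_zero {f : Fin n → ℕ → k} {c q : k} {a : Fin n → k}
    (h : IsGeometricType f c q a) (j : ℕ) : qNat q (1 - q) (j + 1) ≠ 0 := by
  rw [qNat_one_sub, sub_ne_zero]
  exact (h.not_root_of_unity (j + 1) (by omega)).symm

lemma qNat_one_one_ne_zero [CharZero k] (j : ℕ) : qNat (1 : k) 1 (j + 1) ≠ 0 := by
  rw [qNat_one_one]
  exact Nat.cast_ne_zero.2 (by omega)

lemma IsGeometricType.isAffineGrid {f : Fin n → ℕ → k} {c q : k} {a : Fin n → k}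
    (h : IsGeometricType f c q a) {A : ℕ → k} (hA : ∀ i : Fin n, A i = a i)
    {Om : Ptn n → Fin n → k}
    (hOm : ∀ (lam : Ptn n) (i : Fin n), Om lam i = f i (lam.1 i - nextPart lam.1 i)) :
    IsAffineGrid q (c * (1 - q)) (fun i => A i + c) Om := by
  intro lam i
  rw [hOm, h.form, affMap_geometric_iterate, hA, add_comm]

lemma IsArithmeticType.isAffineGrid {f : Fin n → ℕ → k} {d : k} {c : Fin n → k}
    (h : IsArithmeticType f d c) {A : ℕ → k} (hA : ∀ i : Fin n, A i = c i)
    {Om : Ptn n → Fin n → k}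
    (hOm : ∀ (lam : Ptn n) (i : Fin n), Om lam i = f i (lam.1 i - nextPart lam.1 i)) :
    IsAffineGrid 1 d A Om := by
  intro lam i
  rw [hOm, h.form, affMap_arithmetic_iterate, hA]

/-- Extension of a finite sequence by zeros. -/
def extendZero (a : Fin n → k) (i : ℕ) : k := if h : i < n then a ⟨i, h⟩ else 0

lemma extendZero_val (a : Fin n → k) (i : Fin n) : extendZero a i = a i := by simp [extendZero]

end AffineInterpolation

/-! ### Symmetric polynomials on lines and coordinate planes -/

section PolynomialLines

open Finset MvPolynomial

variable {k : Type*} [Field k] {n : ℕ}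

/-- The restriction of a polynomial to the line through `b` with direction `v`. -/
noncomputable def linePoly (b v : Fin n → k) (F : MvPolynomial (Fin n) k) : Polynomial k :=
  aeval (fun i => Polynomial.C (b i) + Polynomial.C (v i) * Polynomial.X) F

/-- The coefficient of degree `N` in the direction `v`. -/
noncomputable def topCoeff (N : ℕ) (v : Fin n → k) (F : MvPolynomial (Fin n) k) : k :=
  (linePoly 0 v F).coeff N

lemma eval_linePoly (b v : Fin n → k) (F : MvPolynomial (Fin n) k) (s : k) :
    (linePoly b v F).eval s = eval (fun i => b i + v i * s) F := by
  unfold linePoly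
  rw [← Polynomial.coe_aeval_eq_eval, ← AlgHom.comp_apply, ← aeval_eq_eval]
  congr 1
  refine algHom_ext fun i => ?_
  simp

lemma natDegree_C_add_C_mul_X_le (a b : k) :
    (Polynomial.C a + Polynomial.C b * Polynomial.X).natDegree ≤ 1 := by
  rw [add_comm]
  exact Polynomial.natDegree_linear_le

lemma natDegree_linePoly_le (b v : Fin n → k) {F : MvPolynomial (Fin n) k} {N : ℕ}
    (hF : F.totalDegree ≤ N) : (linePoly b v F).natDegree ≤ N := by
  have := aeval_natDegree_le F hF
    (fun i => Polynomial.C (b i) + Polynomial.C (v i) * Polynomial.X)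
    fun i => natDegree_C_add_C_mul_X_le _ _
  simpa [linePoly] using this

lemma coeff_prod_linear_pow (s : Finset (Fin n)) (b v : Fin n → k) (e : Fin n → ℕ) :
    (∏ i ∈ s, (Polynomial.C (b i) + Polynomial.C (v i) * Polynomial.X) ^ e i).natDegree ≤
        ∑ i ∈ s, e i ∧
      (∏ i ∈ s, (Polynomial.C (b i) + Polynomial.C (v i) * Polynomial.X) ^ e i).coeff
        (∑ i ∈ s, e i) = ∏ i ∈ s, v i ^ e i := by
  classical
  induction s using Finset.induction_on with
  | empty => simp
  | insert i s hi ih =>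
    have h1 : ((Polynomial.C (b i) + Polynomial.C (v i) * Polynomial.X) ^ e i).natDegree ≤ e i :=
      Polynomial.natDegree_pow_le.trans (by
        simpa using Nat.mul_le_mul_left (e i) (natDegree_C_add_C_mul_X_le (b i) (v i)))
    have h2 : ((Polynomial.C (b i) + Polynomial.C (v i) * Polynomial.X) ^ e i).coeff (e i) =
        v i ^ e i := by
      have := Polynomial.coeff_pow_of_natDegree_le (m := e i)
        (natDegree_C_add_C_mul_X_le (b i) (v i))
      simpa [Polynomial.coeff_C] using this
    rw [prod_insert hi, sum_insert hi, prod_insert hi]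
    refine ⟨Polynomial.natDegree_mul_le.trans (add_le_add h1 ih.1), ?_⟩
    rw [Polynomial.coeff_mul_add_eq_of_natDegree_le h1 ih.1, h2, ih.2]

/-- The leading coefficient along a line depends on the direction only. -/
lemma coeff_linePoly (b v : Fin n → k) {F : MvPolynomial (Fin n) k} {N : ℕ}
    (hF : F.totalDegree ≤ N) : (linePoly b v F).coeff N = topCoeff N v F := by
  have main : ∀ b : Fin n → k, (linePoly b v F).coeff N =
      ∑ e ∈ F.support, F.coeff e * if ∑ i, e i = N then ∏ i, v i ^ e i else 0 := by
    intro b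
    rw [linePoly, aeval_def, eval₂_eq', Polynomial.finsetSum_coeff]
    refine sum_congr rfl fun e he => ?_
    rw [Polynomial.algebraMap_eq, Polynomial.coeff_C_mul]
    congr 1
    obtain ⟨h1, h2⟩ := coeff_prod_linear_pow univ b v e
    split_ifs with h
    · rw [← h, h2]
    · refine Polynomial.coeff_eq_zero_of_natDegree_lt (h1.trans_lt (lt_of_le_of_ne ?_ h))
      refine le_trans (le_of_eq ?_) ((le_totalDegree he).trans hF)
      refine (sum_subset (subset_univ _) fun i _ hi => ?_).symm
      simpa using hi
  rw [topCoeff, main, main]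

lemma topCoeff_comp_perm {F : MvPolynomial (Fin n) k} (hF : F.IsSymmetric) (N : ℕ)
    (v : Fin n → k) (σ : Equiv.Perm (Fin n)) : topCoeff N (v ∘ σ) F = topCoeff N v F := by
  unfold topCoeff linePoly
  conv_rhs => rw [← hF σ, aeval_rename]
  rfl

lemma topCoeff_sub (N : ℕ) (v : Fin n → k) (F G : MvPolynomial (Fin n) k) :
    topCoeff N v (F - G) = topCoeff N v F - topCoeff N v G := by
  simp [topCoeff, linePoly]

lemma topCoeff_C_mul (N : ℕ) (v : Fin n → k) (c : k) (F : MvPolynomial (Fin n) k) :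
    topCoeff N v (C c * F) = c * topCoeff N v F := by
  simp [topCoeff, linePoly]

/-- Restriction to a line parallel to a coordinate axis. -/
lemma eval_linePoly_single (b : Fin n → k) (i : Fin n) (F : MvPolynomial (Fin n) k) (s : k) :
    (linePoly (Function.update b i 0) (Pi.single i 1) F).eval s =
      eval (Function.update b i s) F := by
  rw [eval_linePoly]
  congr 2
  funext j
  by_cases h : j = i
  · subst h; simp
  · simp [h]

/-- The difference of the two sides has degree below N and N distinct roots. The coefficient of
degree N may be zero, so nothing is assumed about the exact degree. -/
lemma eq_C_mul_prod_of_roots {p : Polynomial k} {N : ℕ} (hp : p.natDegree ≤ N) (r : ℕ → k)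
    (hr : ∀ a < N, ∀ b < N, r a = r b → a = b) (h : ∀ a < N, p.eval (r a) = 0) :
    p = Polynomial.C (p.coeff N) * ∏ a ∈ range N, (Polynomial.X - Polynomial.C (r a)) := by
  set Q : Polynomial k := ∏ a ∈ range N, (Polynomial.X - Polynomial.C (r a)) with hQ
  have hmonic : Q.Monic := Polynomial.monic_prod_of_monic _ _ fun a _ => Polynomial.monic_X_sub_C _
  have hdeg : Q.natDegree = N := by
    rw [hQ, Polynomial.natDegree_prod_of_monic _ _ fun a _ => Polynomial.monic_X_sub_C _]
    simp
  have hcoeff : Q.coeff N = 1 := by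
    rw [← hdeg]; exact hmonic
  rw [← sub_eq_zero]
  set D := p - Polynomial.C (p.coeff N) * Q with hD
  have hDroot : ∀ a < N, D.eval (r a) = 0 := by
    intro a ha
    rw [hD, Polynomial.eval_sub, h a ha, Polynomial.eval_mul, hQ, Polynomial.eval_prod,
      prod_eq_zero (mem_range.2 ha) (by simp)]
    simp
  have hDdeg : D.natDegree ≤ N := by
    refine (Polynomial.natDegree_sub_le _ _).trans (max_le hp ?_)
    exact (Polynomial.natDegree_C_mul_le _ _).trans hdeg.le
  have hDN : D.coeff N = 0 := by
    rw [hD, Polynomial.coeff_sub, Polynomial.coeff_C_mul, hcoeff, mul_one, sub_self]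
  -- For N = 0 the bound `natDegree < N` is unattainable, even by the zero polynomial.
  rcases Nat.eq_zero_or_pos N with rfl | hN
  · rw [Polynomial.eq_C_of_natDegree_le_zero hDdeg, hDN, Polynomial.C_0]
  have hlt : D.natDegree < N := by
    refine lt_of_le_of_ne hDdeg fun heq => ?_
    rw [← heq] at hDN
    have h0 : D = 0 := Polynomial.leadingCoeff_eq_zero.1 hDN
    rw [h0, Polynomial.natDegree_zero] at heq
    omega
  refine Polynomial.eq_zero_of_natDegree_lt_card_of_eval_eq_zero D (f := fun a : Fin N => r a) ?_
    (fun a => hDroot a a.2) (by simpa using hlt)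
  intro a b hab
  exact Fin.ext (hr a a.2 b b.2 hab)

lemma eval_update_eq_of_roots {F : MvPolynomial (Fin n) k} {N : ℕ} (hF : F.totalDegree ≤ N)
    (b : Fin n → k) (i : Fin n) (r : ℕ → k)
    (hr : ∀ a < N, ∀ b < N, r a = r b → a = b)
    (h : ∀ a < N, eval (Function.update b i (r a)) F = 0) (s : k) :
    eval (Function.update b i s) F =
      topCoeff N (Pi.single i 1) F * ∏ a ∈ range N, (s - r a) := by
  have h1 := eq_C_mul_prod_of_roots
    (natDegree_linePoly_le (Function.update b i 0) (Pi.single i 1) hF) r hr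
    fun a ha => by rw [eval_linePoly_single]; exact h a ha
  rw [coeff_linePoly _ _ hF] at h1
  rw [← eval_linePoly_single, h1]
  simp [Polynomial.eval_prod]

lemma exists_perm_pair {i j i' j' : Fin n} (h : i ≠ j) (h' : i' ≠ j') :
    ∃ σ : Equiv.Perm (Fin n), σ i = i' ∧ σ j = j' := by
  refine ⟨Equiv.swap (Equiv.swap i i' j) j' * Equiv.swap i i', ?_, ?_⟩
  · rw [Equiv.Perm.mul_apply, Equiv.swap_apply_left]
    refine Equiv.swap_apply_of_ne_of_ne ?_ h'
    intro heq
    have : Equiv.swap i i' j = Equiv.swap i i' i := by rw [← heq, Equiv.swap_apply_left]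
    exact h ((Equiv.swap i i').injective this).symm
  · rw [Equiv.Perm.mul_apply, Equiv.swap_apply_left]

lemma single_comp_perm (i : Fin n) (c : k) (σ : Equiv.Perm (Fin n)) :
    (Pi.single (σ i) c : Fin n → k) ∘ σ = Pi.single i c := by
  funext j
  by_cases h : j = i
  · subst h; simp
  · simp [h]

/-- This makes the constants in the quadratic relation independent of the pair of coordinates, which
is how a single ratio q arises. -/
lemma topCoeff_pair_eq {F : MvPolynomial (Fin n) k} (hF : F.IsSymmetric) (N : ℕ) (c c' : k)
    {i j i' j' : Fin n} (h : i ≠ j) (h' : i' ≠ j') :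
    topCoeff N (Pi.single i c + Pi.single j c') F =
      topCoeff N (Pi.single i' c + Pi.single j' c') F := by
  obtain ⟨σ, rfl, rfl⟩ := exists_perm_pair h h'
  have h1 : (Pi.single (σ i) c + Pi.single (σ j) c' : Fin n → k) ∘ σ =
      Pi.single i c + Pi.single j c' := by
    funext r
    exact congrArg₂ (· + ·) (congrFun (single_comp_perm i c σ) r)
      (congrFun (single_comp_perm j c' σ) r)
  rw [← h1]
  exact topCoeff_comp_perm hF N _ σ

lemma topCoeff_single_eq {F : MvPolynomial (Fin n) k} (hF : F.IsSymmetric) (N : ℕ) (c : k)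
    (i i' : Fin n) : topCoeff N (Pi.single i c) F = topCoeff N (Pi.single i' c) F := by
  rw [← topCoeff_comp_perm hF N (Pi.single i' c) (Equiv.swap i i')]
  congr 1
  rw [← single_comp_perm i c (Equiv.swap i i'), Equiv.swap_apply_left]

lemma eval_update_update_comm {F : MvPolynomial (Fin n) k} (hF : F.IsSymmetric) (b : Fin n → k)
    {i j : Fin n} (hij : i ≠ j) (x y : k) :
    eval (Function.update (Function.update b i x) j y) F =
      eval (Function.update (Function.update b i y) j x) F := by
  conv_lhs => rw [← hF (Equiv.swap i j), eval_rename]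
  congr 2
  funext r
  by_cases h1 : r = i
  · subst h1; simp [hij]
  by_cases h2 : r = j
  · subst h2; simp [hij]
  · simp [Equiv.swap_apply_of_ne_of_ne h1 h2, h1, h2]

/-- The relation between the zeros of a symmetric polynomial of degree two on two coordinate
lines. -/
lemma quadratic_relation [CharZero k] {F : MvPolynomial (Fin n) k} (hF : F.IsSymmetric)
    (hdeg : F.totalDegree ≤ 2) (b : Fin n → k) {i j : Fin n} (hij : i ≠ j) {x y : k}
    (hx : x ≠ b i) (hy : y ≠ b j) (h0 : eval b F = 0) (h1 : eval (Function.update b i x) F = 0)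
    (h2 : eval (Function.update b j y) F = 0) :
    topCoeff 2 (Pi.single i 1) F * (b i - b j) * (b i - b j + x - y) =
      (topCoeff 2 (Pi.single i 1 + Pi.single j 1) F -
        topCoeff 2 (Pi.single i 1 + Pi.single j (-1)) F) / 2 * (b i - b j) ^ 2 ∧
    (b i = b j → topCoeff 2 (Pi.single i 1) F ≠ 0 → x = y) := by
  have two_roots : ∀ (i : Fin n) (x : k), x ≠ b i → eval (Function.update b i x) F = 0 → ∀ s,
      eval (Function.update b i s) F = topCoeff 2 (Pi.single i 1) F * ((s - b i) * (s - x)) := by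
    intro i x hx h s
    have := eval_update_eq_of_roots hdeg b i (fun a => if a = 0 then b i else x) ?_ ?_ s
    · simpa [prod_range_succ] using this
    · intro a ha c hc hac
      interval_cases a <;> interval_cases c <;> simp_all
    · intro a ha
      interval_cases a <;> simp_all
  have line_i := two_roots i x hx h1
  have line_j := two_roots j y hy h2
  rw [topCoeff_single_eq hF 2 1 j i] at line_j
  set α := topCoeff 2 (Pi.single i 1) F
  -- The four corners of the square {b i, b j}² in the plane of coordinates i, j: the two on the
  -- diagonal lie on the lines where F is factored, the other two are zeros, being the base point
  -- and its reflection.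
  have K1 : eval (Function.update (Function.update b i (b i)) j (b i)) F =
      α * ((b i - b j) * (b i - y)) := by
    rw [Function.update_eq_self, line_j]
  have K2 : eval (Function.update (Function.update b i (b j)) j (b j)) F =
      α * ((b j - b i) * (b j - x)) := by
    rw [← line_i, Function.update_comm hij, Function.update_eq_self]
  have K3 : eval (Function.update (Function.update b i (b i)) j (b j)) F = 0 := by
    rw [Function.update_eq_self, Function.update_eq_self, h0]
  have K4 : eval (Function.update (Function.update b i (b j)) j (b i)) F = 0 := by
    rw [eval_update_update_comm hF b hij, K3]
  -- Second differences of a quadratic polynomial. Taken along both diagonals of the square, their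
  -- difference eliminates the unknown value at the centre.
  have quad : ∀ (z v : Fin n → k) (s : k), eval (fun r => z r + v r * s) F +
      eval (fun r => z r + v r * (-s)) F - 2 * eval z F = 2 * topCoeff 2 v F * s ^ 2 := by
    intro z v s
    have e0 : eval z F = (linePoly z v F).eval 0 := by rw [eval_linePoly]; simp
    rw [e0, ← eval_linePoly, ← eval_linePoly, ← coeff_linePoly z v hdeg]
    have hd := natDegree_linePoly_le z v hdeg
    rw [Polynomial.eval_eq_sum_range' (Nat.lt_succ_of_le hd),
      Polynomial.eval_eq_sum_range' (Nat.lt_succ_of_le hd),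
      Polynomial.eval_eq_sum_range' (Nat.lt_succ_of_le hd)]
    simp only [sum_range_succ, sum_range_zero]
    ring
  constructor
  · set z : Fin n → k := Function.update (Function.update b i ((b i + b j) / 2)) j
      ((b i + b j) / 2) with hz
    have coord : ∀ (c x y : k), x = (b i + b j) / 2 + (b i - b j) / 2 →
        y = (b i + b j) / 2 + c * ((b i - b j) / 2) →
        Function.update (Function.update b i x) j y =
          fun r => z r + (Pi.single i 1 + Pi.single j c : Fin n → k) r * ((b i - b j) / 2) := by
      intro c x y hx hy
      funext r
      by_cases h1 : r = i
      · subst h1; simp [hz, hij, hx]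
      by_cases h2 : r = j
      · subst h2; simp [hz, h1, hy]
      · simp [hz, h1, h2]
    have coord' : ∀ (c x y : k), x = (b i + b j) / 2 - (b i - b j) / 2 →
        y = (b i + b j) / 2 - c * ((b i - b j) / 2) →
        Function.update (Function.update b i x) j y =
          fun r => z r + (Pi.single i 1 + Pi.single j c : Fin n → k) r * (-((b i - b j) / 2)) := by
      intro c x y hx hy
      funext r
      by_cases h1 : r = i
      · subst h1; simp [hz, hij, hx]; ring
      by_cases h2 : r = j
      · subst h2; simp [hz, h1, hy]; ring
      · simp [hz, h1, h2]
    have q1 := quad z (Pi.single i 1 + Pi.single j 1) ((b i - b j) / 2)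
    have q2 := quad z (Pi.single i 1 + Pi.single j (-1)) ((b i - b j) / 2)
    rw [← coord 1 (b i) (b i) (by ring) (by ring), ← coord' 1 (b j) (b j) (by ring) (by ring),
      K1, K2] at q1
    rw [← coord (-1) (b i) (b j) (by ring) (by ring), ← coord' (-1) (b j) (b i) (by ring) (by ring),
      K3, K4] at q2
    linear_combination q1 - q2
  -- If b i = b j, symmetry makes y a zero on the line in direction i, whose only zeros are b i and
  -- x.
  · intro hb hα
    have hs := eval_update_update_comm hF b hij (b i) y
    rw [Function.update_eq_self, h2, Function.update_comm hij, hb, Function.update_eq_self, line_i,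
      hb] at hs
    have h3 := (mul_eq_zero.1 hs.symm).resolve_left hα
    have h4 := (mul_eq_zero.1 h3).resolve_left (sub_ne_zero.2 hy)
    exact (sub_eq_zero.1 h4).symm

/-- A symmetric function of two variables, polynomial of small degree in each variable and on the
diagonal, vanishes if it has sufficiently many zeros. -/
lemma symmetric_eq_zero_of_zeros {K : k → k → k} {l : ℕ} (hl : 3 ≤ l) [Infinite k]
    (hcomm : ∀ x y, K x y = K y x)
    (hpoly : ∀ x, ∃ p : Polynomial k, p.natDegree < l ∧ ∀ y, p.eval y = K x y)
    (hdiag : ∃ p : Polynomial k, p.natDegree ≤ l ∧ ∀ s, p.eval s = K s s)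
    {f g : ℕ → k} (hf : ∀ a < l - 1, ∀ b < l - 1, f a = f b → a = b) (hg : Function.Injective g)
    (hfg : ∀ a < l - 1, ∀ b, f a ≠ g b)
    (h : ∀ a b, a < l - 1 → a + b < l → K (f a) (g b) = 0) (x y : k) : K x y = 0 := by
  classical
  -- In row f(a) the given zeros are g(b) for b < l - a; symmetry and the earlier rows add f(b) for
  -- b < a. These are l zeros in degree below l.
  have hrow : ∀ a, a < l - 1 → ∀ y, K (f a) y = 0 := by
    intro a
    induction a using Nat.strong_induction_on with
    | _ a ih =>
      intro ha y
      obtain ⟨p, hp, hpe⟩ := hpoly (f a)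
      rw [← hpe]
      have hinj : Set.InjOn f (range a) := fun u hu v hv huv => by
        have h1 := mem_range.1 hu
        have h2 := mem_range.1 hv
        exact hf u (by omega) v (by omega) huv
      rw [Polynomial.eq_zero_of_natDegree_lt_card_of_eval_eq_zero' p
        ((range (l - a)).image g ∪ (range a).image f), Polynomial.eval_zero]
      · intro z hz
        rw [hpe]
        rcases mem_union.1 hz with hz | hz
        · obtain ⟨b, hb, rfl⟩ := mem_image.1 hz
          have := mem_range.1 hb
          exact h a b ha (by omega)
        · obtain ⟨b, hb, rfl⟩ := mem_image.1 hz
          have := mem_range.1 hb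
          rw [hcomm]
          exact ih b this (by omega) _
      · rw [card_union_of_disjoint, card_image_of_injective _ hg, card_image_of_injOn hinj,
          card_range, card_range]
        · omega
        · rw [disjoint_left]
          intro z hz hz'
          obtain ⟨b, _, rfl⟩ := mem_image.1 hz
          obtain ⟨c, hc, hcb⟩ := mem_image.1 hz'
          have := mem_range.1 hc
          exact hfg c (by omega) b hcb
  set P : Polynomial k := ∏ a ∈ range (l - 1), (Polynomial.X - Polynomial.C (f a)) with hP
  have hPmonic : P.Monic := Polynomial.monic_prod_of_monic _ _ fun a _ => Polynomial.monic_X_sub_C _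
  have hPdeg : P.natDegree = l - 1 := by
    rw [hP, Polynomial.natDegree_prod_of_monic _ _ fun a _ => Polynomial.monic_X_sub_C _]
    simp
  -- Each section is now a multiple of P, so by symmetry K(x, y) is a constant times P(x) P(y).
  have hfactor : ∀ x, ∃ c, ∀ y, K x y = c * P.eval y := by
    intro x
    obtain ⟨p, hp, hpe⟩ := hpoly x
    refine ⟨p.coeff (l - 1), fun y => ?_⟩
    have := eq_C_mul_prod_of_roots (p := p) (N := l - 1) (by omega) f hf fun a ha => by
      rw [hpe, hcomm, hrow a ha]
    rw [← hpe]
    conv_lhs => rw [this]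
    rw [Polynomial.eval_mul, Polynomial.eval_C]
  choose c hc using hfactor
  have hP0 : P.eval (g 0) ≠ 0 := by
    rw [hP, Polynomial.eval_prod]
    refine prod_ne_zero_iff.2 fun a ha => ?_
    simpa [sub_ne_zero] using (hfg a (mem_range.1 ha) 0).symm
  have hK : ∀ x y, K x y * P.eval (g 0) ^ 2 = K (g 0) (g 0) * P.eval x * P.eval y := by
    intro x y
    have h1 := hc x (g 0)
    have h2 := hc (g 0) x
    have h3 := hc (g 0) (g 0)
    rw [hcomm] at h1
    rw [hc x y]
    linear_combination (-P.eval y * P.eval (g 0)) * (h1 - h2) + (P.eval y * P.eval x) * (-h3)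
  suffices hk : K (g 0) (g 0) = 0 by
    have := hK x y
    rw [hk, zero_mul, zero_mul] at this
    exact (mul_eq_zero.1 this).resolve_right (pow_ne_zero _ hP0)
  -- A nonzero constant would give degree 2(l - 1) on the diagonal, which exceeds l because l ≥ 3.
  by_contra hk
  obtain ⟨p, hp, hpe⟩ := hdiag
  have heq : Polynomial.C (K (g 0) (g 0)) * (P * P) = Polynomial.C (P.eval (g 0) ^ 2) * p := by
    refine Polynomial.funext fun s => ?_
    simp only [Polynomial.eval_mul, Polynomial.eval_C]
    rw [hpe]
    linear_combination -hK s s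
  have hd := congrArg Polynomial.natDegree heq
  rw [Polynomial.natDegree_C_mul hk, Polynomial.natDegree_C_mul (pow_ne_zero _ hP0),
    hPmonic.natDegree_mul hPmonic, hPdeg] at hd
  omega

end PolynomialLines

/-! ### Forced zeros for perfect grids of the given form -/

section PerfectGrids

open Finset MvPolynomial

variable {k : Type*} [Field k] {n : ℕ}

/-- The partition with prescribed differences of consecutive parts. -/
def ptnOfDiff (e : Fin n → ℕ) : Ptn n :=
  ⟨fun i => ∑ r ∈ Ici i, e r, fun _ _ h => sum_le_sum_of_subset (Ici_subset_Ici.2 h)⟩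

lemma nextPart_ptnOfDiff (e : Fin n → ℕ) (i : Fin n) :
    nextPart (ptnOfDiff e).1 i = ∑ r ∈ Ioi i, e r := by
  unfold nextPart ptnOfDiff
  split_ifs with h
  · refine sum_congr ?_ fun _ _ => rfl
    ext r
    rw [mem_Ici, mem_Ioi, Fin.le_def, Fin.lt_def]
    rfl
  · symm
    refine sum_eq_zero fun r hr => ?_
    have h1 := Fin.lt_def.1 (mem_Ioi.1 hr)
    have h2 := r.2
    omega

lemma ptnOfDiff_sub_nextPart (e : Fin n → ℕ) (i : Fin n) :
    (ptnOfDiff e).1 i - nextPart (ptnOfDiff e).1 i = e i := by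
  have h : (ptnOfDiff e).1 i = e i + ∑ r ∈ Ioi i, e r := by
    change ∑ r ∈ Ici i, e r = _
    rw [← Ioi_insert, sum_insert (by simp)]
  rw [nextPart_ptnOfDiff, h, Nat.add_sub_cancel_right]

lemma ptnOfDiff_injective : Function.Injective (ptnOfDiff (n := n)) := by
  intro e e' h
  funext i
  rw [← ptnOfDiff_sub_nextPart e, ← ptnOfDiff_sub_nextPart e', h]

/-- Points of a non-degenerate grid with different indices are not permutations of each other. -/
lemma IsNondegenerate.comp_perm_ne {Om : Ptn n → Fin n → k} (hOm : IsNondegenerate Om)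
    {lam mu : Ptn n} (hne : lam ≠ mu) (σ : Equiv.Perm (Fin n)) : Om lam ≠ Om mu ∘ σ := by
  wlog hle : mu.size ≤ lam.size generalizing lam mu σ
  · intro h
    refine this hne.symm σ.symm (not_le.1 hle).le ?_
    rw [h, Function.comp_assoc, Equiv.self_comp_symm, Function.comp_id]
  · intro h
    obtain ⟨F, hF⟩ := hOm lam
    have h1 := hF.eval_eq_zero mu hle hne.symm
    rw [← hF.symmetric σ, eval_rename, ← h] at h1
    exact hF.eval_ne_zero h1

/-- Modulo X_i - u the substitution X_i ↦ u is the identity, so G is congruent to its substituted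
value. -/
lemma X_sub_C_dvd_of_bind_eq_zero (i : Fin n) (u : k) (G : MvPolynomial (Fin n) k)
    (h : aeval (Function.update X i (C u) : Fin n → MvPolynomial (Fin n) k) G = 0) :
    X i - C u ∣ G := by
  rw [← Ideal.mem_span_singleton, ← Ideal.Quotient.eq_zero_iff_mem]
  set I := Ideal.span {(X i - C u : MvPolynomial (Fin n) k)} with hI
  have key : (Ideal.Quotient.mkₐ k I).comp
      (aeval (Function.update X i (C u) : Fin n → MvPolynomial (Fin n) k)) =
      Ideal.Quotient.mkₐ k I := by
    refine algHom_ext fun j => ?_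
    rw [AlgHom.comp_apply, aeval_X]
    by_cases hj : j = i
    · subst hj
      rw [Function.update_self]
      symm
      rw [← sub_eq_zero, ← map_sub]
      exact Ideal.Quotient.eq_zero_iff_mem.2 (Ideal.mem_span_singleton_self _)
    · rw [Function.update_of_ne hj]
  have := DFunLike.congr_fun key G
  rw [AlgHom.comp_apply, h, map_zero] at this
  exact this.symm

lemma eval_aeval_update (i : Fin n) (u : k) (G : MvPolynomial (Fin n) k) (x : Fin n → k) :
    eval x (aeval (Function.update X i (C u) : Fin n → MvPolynomial (Fin n) k) G) =
      eval (Function.update x i u) G := by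
  rw [← aeval_eq_eval, ← aeval_eq_eval, ← AlgHom.comp_apply]
  congr 1
  refine algHom_ext fun j => ?_
  by_cases hj : j = i
  · subst hj; simp
  · simp [hj]

lemma X_sub_C_ne_zero' (i : Fin n) (u : k) : (X i - C u : MvPolynomial (Fin n) k) ≠ 0 := by
  intro h
  have := congrArg (eval (Function.const _ (u + 1))) h
  simp at this

/-- Factors are split off one at a time: substituting X_i ↦ u does not annihilate the other linear
factors, so it annihilates the remaining quotient. -/
lemma prod_X_sub_C_dvd [Infinite k] (s : Finset (Fin n × k)) (F : MvPolynomial (Fin n) k)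
    (h : ∀ p ∈ s, ∀ x : Fin n → k, eval (Function.update x p.1 p.2) F = 0) :
    ∏ p ∈ s, (X p.1 - C p.2) ∣ F := by
  classical
  induction s using Finset.induction_on with
  | empty => simp
  | insert p s hp ih =>
    obtain ⟨G, hG⟩ := ih fun q hq => h q (mem_insert_of_mem hq)
    have hzero : aeval (Function.update X p.1 (C p.2) : Fin n → MvPolynomial (Fin n) k) F = 0 := by
      refine MvPolynomial.funext fun x => ?_
      rw [eval_aeval_update, h p (mem_insert_self _ _), map_zero]
    rw [hG, map_mul, mul_eq_zero, map_prod, prod_eq_zero_iff] at hzero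
    have hGzero := hzero.resolve_left ?_
    · obtain ⟨G', hG'⟩ := X_sub_C_dvd_of_bind_eq_zero p.1 p.2 G hGzero
      refine ⟨G', ?_⟩
      rw [prod_insert hp, hG, hG']
      ring
    · rintro ⟨r, hr, hr0⟩
      rw [map_sub, aeval_X, aeval_C, algebraMap_eq] at hr0
      by_cases hi : r.1 = p.1
      · rw [hi, Function.update_self, ← C_sub, ← C_0] at hr0
        have h2 := sub_eq_zero.1 (C_injective _ _ hr0)
        exact hp (by rwa [show p = r from Prod.ext hi.symm h2])
      · rw [Function.update_of_ne hi] at hr0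
        exact X_sub_C_ne_zero' _ _ hr0

lemma le_totalDegree_prod_X_sub_C (s : Finset (Fin n × k)) :
    s.card ≤ (∏ p ∈ s, (X p.1 - C p.2 : MvPolynomial (Fin n) k)).totalDegree := by
  classical
  induction s using Finset.induction_on with
  | empty => simp
  | insert p s hp ih =>
    rw [prod_insert hp, card_insert_of_notMem hp, totalDegree_mul_of_isDomain
      (X_sub_C_ne_zero' _ _) (prod_ne_zero_iff.2 fun q _ => X_sub_C_ne_zero' _ _), add_comm]
    refine add_le_add ?_ ih
    have h1 := totalDegree_add (X p.1 - C p.2 : MvPolynomial (Fin n) k) (C p.2)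
    rwa [sub_add_cancel, totalDegree_X, totalDegree_C, max_eq_left (Nat.zero_le _)] at h1

/-- The partition `(l + t, t, …, t)`. -/
def rowPtn (n l t : ℕ) : Ptn n :=
  ⟨fun i => (if (i : ℕ) = 0 then l else 0) + t, fun i j h => by
    have := Fin.le_def.1 h
    dsimp only
    split_ifs <;> omega⟩

lemma rowPtn_size (hn : 0 < n) (l t : ℕ) : (rowPtn n l t).size = l + n * t := by
  obtain ⟨m, rfl⟩ := Nat.exists_eq_succ_of_ne_zero hn.ne'
  unfold Ptn.size rowPtn
  rw [sum_add_distrib, Fin.sum_univ_succ]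
  simp

/-- The differences of consecutive parts of `rowPtn n l t`. -/
def rowDiff (n l t : ℕ) (i : Fin n) : ℕ :=
  if (i : ℕ) = 0 then l else if (i : ℕ) + 1 = n then t else 0

lemma rowPtn_sub_nextPart (hn : 2 ≤ n) (l t : ℕ) (i : Fin n) :
    (rowPtn n l t).1 i - nextPart (rowPtn n l t).1 i = rowDiff n l t i := by
  have := i.2
  unfold nextPart rowPtn rowDiff
  dsimp only
  split_ifs <;> first | omega | contradiction

/-- The largest part of a partition is the sum of its differences, and already the first row does
not fit. -/
lemma not_rowPtn_le (hn : 0 < n) {l t : ℕ} {e : Fin n → ℕ} (he : ∑ i, e i < l + t) :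
    ¬ rowPtn n l t ≤ ptnOfDiff e := by
  intro h
  have h1 : (rowPtn n l t).1 ⟨0, hn⟩ ≤ (ptnOfDiff e).1 ⟨0, hn⟩ := h ⟨0, hn⟩
  have h2 : (ptnOfDiff e).1 ⟨0, hn⟩ = ∑ i, e i := by
    refine sum_congr ?_ fun _ _ => rfl
    ext r
    simp [Fin.le_def]
  rw [h2] at h1
  simp only [rowPtn, if_true] at h1
  omega

lemma sum_update_zero (e : Fin n → ℕ) (i : Fin n) (a : ℕ) :
    ∑ r, Function.update e i a r = a + ∑ r ∈ univ.erase i, e r := by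
  rw [← add_sum_erase _ _ (mem_univ i), Function.update_self]
  congr 1
  exact sum_congr rfl fun r hr => Function.update_of_ne (ne_of_mem_erase hr) _ _

section

variable {f : Fin n → ℕ → k} {Om : Ptn n → Fin n → k}

lemma grid_ptnOfDiff {K : Type*} {f : Fin n → ℕ → K} {Om : Ptn n → Fin n → K}
    (hOm : ∀ (lam : Ptn n) (i : Fin n), Om lam i = f i (lam.1 i - nextPart lam.1 i))
    (e : Fin n → ℕ) : Om (ptnOfDiff e) = fun i => f i (e i) := by
  funext i
  rw [hOm, ptnOfDiff_sub_nextPart]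

lemma IsNondegenerate.injective (hnd : IsNondegenerate Om)
    (hOm : ∀ (lam : Ptn n) (i : Fin n), Om lam i = f i (lam.1 i - nextPart lam.1 i))
    (i : Fin n) : Function.Injective (f i) := by
  intro a b hab
  by_contra hne
  refine hnd.comp_perm_ne (lam := ptnOfDiff (Pi.single i a)) (mu := ptnOfDiff (Pi.single i b)) ?_ 1
    ?_
  · intro h
    have := congrFun (ptnOfDiff_injective h) i
    simp only [Pi.single_eq_same] at this
    exact hne this
  · rw [grid_ptnOfDiff hOm, grid_ptnOfDiff hOm]
    funext r
    by_cases h : r = i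
    · subst h; simpa using hab
    · simp [h]

/-- A partition whose last part is j cannot contain `lam`, so perfectness gives zeros at all grid
points with last coordinate f_L(j). The other coordinates range independently over infinite sets,
hence F vanishes on the whole hyperplane. -/
lemma IsPerfect.eval_update_last_eq_zero [Infinite k] (hp : IsPerfect Om)
    (hOm : ∀ (lam : Ptn n) (i : Fin n), Om lam i = f i (lam.1 i - nextPart lam.1 i))
    {lam : Ptn n} {F : MvPolynomial (Fin n) k} (hF : IsInterpolation Om lam F) {L : Fin n}
    (hL : (L : ℕ) + 1 = n) {j : ℕ} (hj : j < lam.1 L) (x : Fin n → k) :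
    eval (Function.update x L (f L j)) F = 0 := by
  rw [← eval_aeval_update]
  suffices h : aeval (Function.update X L (C (f L j)) : Fin n → MvPolynomial (Fin n) k) F = 0 by
    rw [h, map_zero]
  refine funext_set (fun i => Set.range (f i))
    (fun i => Set.infinite_range_of_injective (hp.1.injective hOm i)) fun x hx => ?_
  choose e he using fun i => hx i trivial
  rw [eval_aeval_update, map_zero]
  have hpt : Function.update x L (f L j) = Om (ptnOfDiff (Function.update e L j)) := by
    rw [grid_ptnOfDiff hOm]
    funext i
    by_cases h : i = L
    · subst h; simp
    · simp [h, he]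
  rw [hpt]
  refine hp.2 lam F hF _ fun hle => ?_
  have h1 : lam.1 L ≤ (ptnOfDiff (Function.update e L j)).1 L := hle L
  have h2 := ptnOfDiff_sub_nextPart (Function.update e L j) L
  have h3 : nextPart (ptnOfDiff (Function.update e L j)).1 L = 0 := by
    unfold nextPart; rw [dif_neg (by omega)]
  rw [h3, Function.update_self] at h2
  omega

lemma IsPerfect.eval_update_eq_zero [Infinite k] (hp : IsPerfect Om)
    (hOm : ∀ (lam : Ptn n) (i : Fin n), Om lam i = f i (lam.1 i - nextPart lam.1 i))
    {lam : Ptn n} {F : MvPolynomial (Fin n) k} (hF : IsInterpolation Om lam F) {L : Fin n}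
    (hL : (L : ℕ) + 1 = n) {j : ℕ} (hj : j < lam.1 L) (i : Fin n) (x : Fin n → k) :
    eval (Function.update x i (f L j)) F = 0 := by
  rw [← hF.symmetric (Equiv.swap i L), eval_rename]
  have : Function.update x i (f L j) ∘ Equiv.swap i L =
      Function.update (x ∘ Equiv.swap i L) L (f L j) := by
    rw [← Equiv.swap_apply_left i L, Function.update_comp_equiv]
    simp
  rw [this]
  exact hp.eval_update_last_eq_zero hOm hF hL hj _

/-- If f_i(a) = f_L(b), the grid point with differences a at i and b + 1 at L lies on the hyperplane
x_i = f_L(b), where its own interpolation polynomial vanishes. -/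
lemma IsPerfect.ne_last [Infinite k] (hp : IsPerfect Om)
    (hOm : ∀ (lam : Ptn n) (i : Fin n), Om lam i = f i (lam.1 i - nextPart lam.1 i))
    {L : Fin n} (hL : (L : ℕ) + 1 = n) {i : Fin n} (hi : i ≠ L) (a b : ℕ) : f i a ≠ f L b := by
  intro h
  set e : Fin n → ℕ := Function.update (Pi.single i a) L (b + 1) with he
  obtain ⟨F, hF⟩ := hp.1 (ptnOfDiff e)
  have h2 := ptnOfDiff_sub_nextPart e L
  have h3 : nextPart (ptnOfDiff e).1 L = 0 := by
    unfold nextPart; rw [dif_neg (by omega)]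
  rw [h3, he, Function.update_self] at h2
  refine hF.eval_ne_zero ?_
  have h4 : Om (ptnOfDiff e) = Function.update (Om (ptnOfDiff e)) i (f L b) := by
    rw [← h]
    symm
    rw [Function.update_eq_self_iff, grid_ptnOfDiff hOm, he]
    simp [hi]
  rw [h4]
  exact hp.eval_update_eq_zero hOm hF hL (by rw [← he] at h2; omega) i _

/-- Interpolation polynomials with index `(l + t, t, …, t)`, after division by their obvious
factors. -/
lemma IsPerfect.exists_row [Infinite k] (hp : IsPerfect Om)
    (hOm : ∀ (lam : Ptn n) (i : Fin n), Om lam i = f i (lam.1 i - nextPart lam.1 i))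
    (hn : 2 ≤ n) {L : Fin n} (hL : (L : ℕ) + 1 = n) (l t : ℕ) :
    ∃ H : MvPolynomial (Fin n) k, H.IsSymmetric ∧ H.totalDegree ≤ l ∧
      (∀ e : Fin n → ℕ, t ≤ e L → ∑ i, e i < l + t → eval (fun i => f i (e i)) H = 0) ∧
      eval (fun i => f i (rowDiff n l t i)) H ≠ 0 := by
  classical
  obtain ⟨F, hF⟩ := hp.1 (rowPtn n l t)
  have hinj := hp.1.injective hOm L
  have hLne : (L : ℕ) ≠ 0 := by omega
  set s : Finset (Fin n × k) := univ ×ˢ (range t).image (f L) with hs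
  have hrowL : (rowPtn n l t).1 L = t := by simp [rowPtn, hLne]
  obtain ⟨H, hH⟩ := prod_X_sub_C_dvd s F fun p hps x => by
    obtain ⟨j, hj, hjp⟩ := mem_image.1 (mem_product.1 hps).2
    rw [← hjp]
    exact hp.eval_update_eq_zero hOm hF hL (by rw [hrowL]; exact mem_range.1 hj) p.1 x
  set E : MvPolynomial (Fin n) k := ∏ p ∈ s, (X p.1 - C p.2) with hE
  have hE0 : E ≠ 0 := prod_ne_zero_iff.2 fun q _ => X_sub_C_ne_zero' _ _
  have hpt : Om (rowPtn n l t) = fun i => f i (rowDiff n l t i) := by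
    funext i
    rw [hOm, rowPtn_sub_nextPart hn]
  have hval := hF.eval_ne_zero
  rw [hpt, hH, map_mul] at hval
  have hH0 : H ≠ 0 := by
    rintro rfl
    simp at hval
  refine ⟨H, fun σ => ?_, ?_, fun e het hsum => ?_, right_ne_zero_of_mul hval⟩
  · have hEσ : rename σ E = E := by
      rw [hE, map_prod]
      refine prod_equiv (σ.prodCongr (Equiv.refl k)) (fun p => ?_) fun p _ => ?_
      · simp [hs]
      · simp
    have h1 := hF.symmetric σ
    rw [hH, map_mul, hEσ] at h1
    exact mul_left_cancel₀ hE0 h1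
  -- The index has size l + n t and the divisor has degree at least n t, which leaves at most l.
  · have h1 := hF.degree_le
    rw [hH, totalDegree_mul_of_isDomain hE0 hH0, rowPtn_size (by omega)] at h1
    have h2 := le_totalDegree_prod_X_sub_C s
    rw [hs, card_product, card_image_of_injective _ hinj, card_range, card_univ,
      Fintype.card_fin] at h2
    rw [hE, hs] at h1
    omega
  -- The divisor is nonzero at these points: e_L ≥ t keeps the last coordinate off f_L(j) for j < t,
  -- and the other coordinates never take values of f_L.
  · have h1 := hp.2 _ F hF (ptnOfDiff e) (not_rowPtn_le (by omega) hsum)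
    rw [grid_ptnOfDiff hOm, hH, map_mul] at h1
    refine (mul_eq_zero.1 h1).resolve_left ?_
    rw [hE, map_prod]
    refine prod_ne_zero_iff.2 fun p hps => ?_
    obtain ⟨j, hj, hjp⟩ := mem_image.1 (mem_product.1 hps).2
    have hj' := mem_range.1 hj
    rw [map_sub, eval_X, eval_C, sub_ne_zero, ← hjp]
    by_cases hi : p.1 = L
    · rw [hi]
      intro h
      have := hinj h
      omega
    · exact hp.ne_last hOm hL hi _ _

end

end PerfectGrids

/-! ### Classification of perfect grids -/

section Classification

open Finset MvPolynomial

variable {k : Type*} [Field k] {n : ℕ}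

lemma affMap_iterate_eq (q d u : k) (m : ℕ) :
    (affMap q d)^[m] u = q ^ m * u + d * ∑ i ∈ range m, q ^ i := by
  induction m with
  | zero => simp
  | succ m ih =>
    rw [Function.iterate_succ_apply', ih, affMap, geom_sum_succ, pow_succ]
    ring

/-- T^m u - u = (1 + q + ⋯ + q^(m-1)) (T u - u), so an orbit that moves at the first step never
returns. -/
lemma affMap_iterate_injective {q d u : k} (hq : q ≠ 0) (hB : ∀ j, qNat q 1 (j + 1) ≠ 0)
    (hu : affMap q d u ≠ u) : Function.Injective fun m => (affMap q d)^[m] u := by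
  have key : ∀ a m : ℕ, (affMap q d)^[a + (m + 1)] u ≠ (affMap q d)^[a] u := by
    intro a m h
    rw [Function.iterate_add_apply, ← sub_eq_zero, affMap_iterate_sub] at h
    have h1 := (mul_eq_zero.1 h).resolve_left (pow_ne_zero _ hq)
    have h2 := hB m
    rw [qNat, one_mul] at h2
    have h3 : (affMap q d)^[m + 1] u - u = (∑ i ∈ range (m + 1), q ^ i) * (affMap q d u - u) := by
      rw [affMap_iterate_eq, affMap]
      linear_combination (-u) * mul_geom_sum q (m + 1)
    rw [h3] at h1
    exact (mul_ne_zero h2 (sub_ne_zero.2 hu)) h1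
  intro a b hab
  by_contra hne
  rcases lt_or_gt_of_ne hne with h | h
  · obtain ⟨m, rfl⟩ := Nat.exists_eq_add_of_lt h
    exact key a m hab.symm
  · obtain ⟨m, rfl⟩ := Nat.exists_eq_add_of_lt h
    exact key b m hab

lemma update_point {K : Type*} (f : Fin n → ℕ → K) (e : Fin n → ℕ) (i : Fin n) (a : ℕ) :
    (fun r => f r (Function.update e i a r)) = Function.update (fun r => f r (e r)) i (f i a) := by
  funext r
  by_cases h : r = i
  · subst h; simp
  · simp [h]

lemma sum_single_nat (i : Fin n) (a : ℕ) : ∑ r, (Pi.single i a : Fin n → ℕ) r = a := by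
  simp

lemma sum_update_single {i L : Fin n} (h : i ≠ L) (a b : ℕ) :
    ∑ r, Function.update (Pi.single L b : Fin n → ℕ) i a r = a + b := by
  rw [sum_update_zero, sum_eq_single_of_mem L (mem_erase.2 ⟨h.symm, mem_univ _⟩)]
  · simp
  · intro r _ hr
    simp [hr]

lemma rowDiff_eq_update {i0 L : Fin n} (h0 : (i0 : ℕ) = 0) (hL : (L : ℕ) + 1 = n) (hne : i0 ≠ L)
    (l t : ℕ) : rowDiff n l t = Function.update (Pi.single L t) i0 l := by
  funext r
  unfold rowDiff
  by_cases h1 : r = i0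
  · subst h1; simp [h0]
  · rw [if_neg (by rw [← h0]; exact fun h => h1 (Fin.ext h)), Function.update_of_ne h1]
    by_cases h2 : r = L
    · subst h2; simp [hL]
    · rw [if_neg, Pi.single_eq_of_ne h2]
      intro h
      exact h2 (Fin.ext (by omega))

/-- A polynomial that vanishes on the row progression up to `l` but not at its end has a nonzero
leading coefficient. -/
lemma topCoeff_ne_zero_of_row {F : MvPolynomial (Fin n) k} {l : ℕ} (hF : F.totalDegree ≤ l)
    (b : Fin n → k) (i : Fin n) (r : ℕ → k) (hr : Function.Injective r)
    (h : ∀ a < l, eval (Function.update b i (r a)) F = 0)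
    (hne : eval (Function.update b i (r l)) F ≠ 0) : topCoeff l (Pi.single i 1) F ≠ 0 := by
  intro h0
  rw [eval_update_eq_of_roots hF b i r (fun a _ c _ hac => hr hac) h, h0, zero_mul] at hne
  exact hne rfl

variable {f : Fin n → ℕ → k} {Om : Ptn n → Fin n → k}

/-- The reduced polynomial with l = 2 vanishes at a base point and one step away from it in every
direction. The resulting relation says that one step multiplies the difference of two coordinates by
a factor common to all pairs with distinct base values. A pair avoiding L, which exists because n ≥
3, does not see t, so this factor q is the same for all t. -/
lemma IsPerfect.exists_affMap [CharZero k] (hp : IsPerfect Om)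
    (hOm : ∀ (lam : Ptn n) (i : Fin n), Om lam i = f i (lam.1 i - nextPart lam.1 i))
    (hn : 3 ≤ n) {L : Fin n} (hL : (L : ℕ) + 1 = n) :
    ∃ q d : k, (∀ t, f L (t + 1) = affMap q d (f L t)) ∧ ∀ i, f i 1 = affMap q d (f i 0) := by
  have hinj := fun i => hp.1.injective hOm i
  set i0 : Fin n := ⟨0, by omega⟩ with hi0
  set i1 : Fin n := ⟨1, by omega⟩ with hi1
  have h01 : i0 ≠ i1 := by simp [hi0, hi1]
  have h0L : i0 ≠ L := fun h => by have := congrArg Fin.val h; simp [hi0] at this; omega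
  have h1L : i1 ≠ L := fun h => by have := congrArg Fin.val h; simp [hi1] at this; omega
  have rel : ∀ t, ∃ α β : k, α ≠ 0 ∧ ∀ i j, i ≠ j →
      (α * (f i ((Pi.single L t : Fin n → ℕ) i) - f j ((Pi.single L t : Fin n → ℕ) j)) *
        (f i ((Pi.single L t : Fin n → ℕ) i) - f j ((Pi.single L t : Fin n → ℕ) j) +
          f i ((Pi.single L t : Fin n → ℕ) i + 1) - f j ((Pi.single L t : Fin n → ℕ) j + 1)) =
        β * (f i ((Pi.single L t : Fin n → ℕ) i) - f j ((Pi.single L t : Fin n → ℕ) j)) ^ 2) ∧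
      (f i ((Pi.single L t : Fin n → ℕ) i) = f j ((Pi.single L t : Fin n → ℕ) j) →
        f i ((Pi.single L t : Fin n → ℕ) i + 1) = f j ((Pi.single L t : Fin n → ℕ) j + 1)) := by
    intro t
    obtain ⟨H, hsym, hdeg, hzero, hne⟩ := hp.exists_row hOm (by omega) hL 2 t
    set e : Fin n → ℕ := Pi.single L t with he
    have heL : e L = t := by simp [he]
    have hbase : eval (fun r => f r (e r)) H = 0 :=
      hzero e heL.ge (by rw [he, sum_single_nat]; omega)
    have hstep : ∀ i, eval (Function.update (fun r => f r (e r)) i (f i (e i + 1))) H = 0 := by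
      intro i
      rw [← update_point]
      by_cases h : i = L
      · subst h
        refine hzero _ (by simp [heL]) ?_
        rw [he, sum_update_zero, sum_eq_zero fun r hr => Pi.single_eq_of_ne (ne_of_mem_erase hr) _]
        simp; omega
      · refine hzero _ (by rw [Function.update_of_ne (Ne.symm h), heL]) ?_
        rw [he, Pi.single_eq_of_ne h, sum_update_single h]
        omega
    have hα : topCoeff 2 (Pi.single i0 1) H ≠ 0 := by
      refine topCoeff_ne_zero_of_row hdeg (fun r => f r (e r)) i0 (f i0) (hinj i0)
        (fun a ha => ?_) ?_
      · rw [← update_point]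
        refine hzero _ (by rw [Function.update_of_ne h0L.symm, heL]) ?_
        rw [he, sum_update_single h0L]
        omega
      · rw [← update_point, he, ← rowDiff_eq_update rfl hL h0L]
        exact hne
    refine ⟨topCoeff 2 (Pi.single i0 1) H,
      (topCoeff 2 (Pi.single i0 1 + Pi.single i1 1) H -
        topCoeff 2 (Pi.single i0 1 + Pi.single i1 (-1)) H) / 2, hα, fun i j hij => ?_⟩
    have hne1 : ∀ i, f i (e i + 1) ≠ f i (e i) := fun i h => by
      have := hinj i h
      omega
    have := quadratic_relation hsym hdeg (fun r => f r (e r)) hij (hne1 i) (hne1 j) hbase (hstep i)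
      (hstep j)
    rw [topCoeff_single_eq hsym 2 1 i i0, topCoeff_pair_eq hsym 2 1 1 hij h01,
      topCoeff_pair_eq hsym 2 1 (-1) hij h01] at this
    exact ⟨this.1, fun h => this.2 h hα⟩
  -- If these values agreed, the second part of the relation would make f i0 1 and f i1 1 agree, and
  -- two different grid points would be permutations of each other.
  have hD : f i0 0 ≠ f i1 0 := by
    intro h
    obtain ⟨α, β, hα, hrel⟩ := rel 0
    have h1 := (hrel i0 i1 h01).2
    simp only [Pi.single_zero, Pi.zero_apply, zero_add] at h1
    refine hp.1.comp_perm_ne (lam := ptnOfDiff (Pi.single i0 1)) (mu := ptnOfDiff (Pi.single i1 1))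
      ?_ (Equiv.swap i0 i1) ?_
    · intro h2
      have := congrFun (ptnOfDiff_injective h2) i0
      simp [h01] at this
    · rw [grid_ptnOfDiff hOm, grid_ptnOfDiff hOm]
      funext r
      simp only [Function.comp_apply]
      by_cases hr0 : r = i0
      · subst hr0; simp [h1 h]
      by_cases hr1 : r = i1
      · subst hr1; simp [h01, hr0, h]
      · simp [Equiv.swap_apply_of_ne_of_ne hr0 hr1, hr0, hr1]
  have hD' := sub_ne_zero.2 hD
  set q : k := (f i0 1 - f i1 1) / (f i0 0 - f i1 0) with hq
  have hq' : f i0 1 - f i1 1 = q * (f i0 0 - f i1 0) := by rw [hq, div_mul_cancel₀ _ hD']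
  -- The pair i0, i1 identifies β as α (1 + q); the pair i, L then compares the step of f_L at t
  -- with the first step of f_i.
  have rel' : ∀ t i, i ≠ L → f L (t + 1) - q * f L t = f i 1 - q * f i 0 := by
    intro t i hi
    obtain ⟨α, β, hα, hrel⟩ := rel t
    have h1 := (hrel i0 i1 h01).1
    have h2 := (hrel i L hi).1
    simp only [Pi.single_eq_of_ne h0L, Pi.single_eq_of_ne h1L, Pi.single_eq_of_ne hi,
      Pi.single_eq_same, zero_add] at h1 h2
    have hiL := sub_ne_zero.2 (hp.ne_last hOm hL hi 0 t)
    have hβ : β = α * (1 + q) := by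
      refine mul_right_cancel₀ (pow_ne_zero 2 hD') ?_
      rw [← h1]
      linear_combination α * (f i0 0 - f i1 0) * hq'
    rw [hβ] at h2
    have h3 : α * (f i 0 - f L t) * (f i 1 - q * f i 0 - (f L (t + 1) - q * f L t)) = 0 := by
      linear_combination h2
    have h4 := (mul_eq_zero.1 h3).resolve_left (mul_ne_zero hα hiL)
    linear_combination -h4
  refine ⟨q, f i0 1 - q * f i0 0, fun t => ?_, fun i => ?_⟩
  · rw [affMap]
    linear_combination rel' t i0 h0L
  · rw [affMap]
    by_cases hi : i = L
    · subst hi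
      linear_combination rel' 0 i0 h0L
    · linear_combination rel' 0 i0 h0L - rel' 0 i hi

lemma IsAffineGrid.eval_affInterp_diff_eq_zero {q d β : k} {A : ℕ → k} {Om' : Ptn n → Fin n → k}
    (hA : IsAffineGrid q d A Om') {lam : Ptn n} {e : Fin n → ℕ} (h : ¬ lam ≤ ptnOfDiff e) :
    eval (fun i : Fin n => (affMap q d)^[e i] (A i)) (affInterp q d β A lam) = 0 := by
  have h1 := hA.eval_affInterp_eq_zero (β := β) h
  rwa [show Om' (ptnOfDiff e) = fun i : Fin n => (affMap q d)^[e i] (A i) from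
    funext fun i => by rw [hA, ptnOfDiff_sub_nextPart]] at h1

/-- Let H be the row polynomial of degree l = a + 1 of the grid, and H' that of the affine
progressions. By induction they share enough zeros on the plane of coordinates i, L to be
proportional there. So T^a f_i(0), a zero of H' on the line in direction i, is a zero of H, whose
zeros there are f_i(0), …, f_i(a). -/
lemma IsPerfect.eq_iterate [CharZero k] (hp : IsPerfect Om)
    (hOm : ∀ (lam : Ptn n) (i : Fin n), Om lam i = f i (lam.1 i - nextPart lam.1 i))
    (hn : 3 ≤ n) {L : Fin n} (hL : (L : ℕ) + 1 = n) {q d : k} (hq : q ≠ 0)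
    (hB : ∀ j, qNat q 1 (j + 1) ≠ 0) (hlast : ∀ t, f L (t + 1) = affMap q d (f L t))
    (hone : ∀ i, f i 1 = affMap q d (f i 0)) (i : Fin n) (a : ℕ) :
    f i a = (affMap q d)^[a] (f i 0) := by
  have hinj := fun i => hp.1.injective hOm i
  have hL' : ∀ t, f L t = (affMap q d)^[t] (f L 0) := by
    intro t
    induction t with
    | zero => rfl
    | succ t ih => rw [hlast, ih, Function.iterate_succ_apply']
  by_cases hi : i = L
  · rw [hi]; exact hL' a
  have hTinj : ∀ i, Function.Injective fun m => (affMap q d)^[m] (f i 0) := fun i =>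
    affMap_iterate_injective hq hB (by
      rw [← hone]
      intro h
      exact one_ne_zero (hinj i h))
  set i0 : Fin n := ⟨0, by omega⟩ with hi0
  have h0L : i0 ≠ L := fun h => by have := congrArg Fin.val h; simp [hi0] at this; omega
  induction a using Nat.strong_induction_on with
  | _ a ih =>
    rcases Nat.lt_or_ge a 2 with ha | ha
    · interval_cases a
      · rfl
      · exact hone i
    set l := a + 1 with hl
    set A : ℕ → k := extendZero fun i => f i 0 with hA
    have hAval : ∀ r : Fin n, A r = f r 0 := fun r => extendZero_val _ r
    have hgrid : IsAffineGrid q d A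
        (fun (lam : Ptn n) i => (affMap q d)^[lam.1 i - nextPart lam.1 i] (A i)) := fun _ _ => rfl
    obtain ⟨H, hsym, hdeg, hzero, hne⟩ := hp.exists_row hOm (by omega) hL l 0
    set H' := affInterp q d 1 A (rowPtn n l 0) with hH'
    have hsym' : H'.IsSymmetric := affInterp_isSymmetric hB A _
    have hdeg' : H'.totalDegree ≤ l := by
      have := totalDegree_affInterp_le (q := q) (d := d) (β := 1) A (rowPtn n l 0)
      rwa [rowPtn_size (by omega), mul_zero, add_zero] at this
    have hzero' : ∀ e : Fin n → ℕ, ∑ r, e r < l →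
        eval (fun r => (affMap q d)^[e r] (f r 0)) H' = 0 := by
      intro e he
      have := hgrid.eval_affInterp_diff_eq_zero (β := 1)
        (not_rowPtn_le (n := n) (l := l) (t := 0) (by omega) he)
      simpa only [hAval] using this
    -- Disjointness of the orbits is not yet known. For a one-row index only the first difference is
    -- nonzero, so injectivity of a single orbit suffices.
    have hne' : eval (fun r => (affMap q d)^[rowDiff n l 0 r] (f r 0)) H' ≠ 0 := by
      have := hgrid.eval_affInterp_ne_zero hB (lam := rowPtn n l 0) fun u r j hur hj => ?_
      · simpa only [hAval, rowPtn_sub_nextPart (show 2 ≤ n by omega)] using this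
      · rw [rowPtn_sub_nextPart (by omega)] at hj ⊢
        have hr : (r : ℕ) = 0 := by
          by_contra hr
          rw [rowDiff, if_neg hr] at hj
          simp at hj
        have hu : u = r := Fin.ext (by have := Fin.le_def.1 hur; omega)
        subst hu
        rw [hAval]
        intro h
        have := hTinj u h
        omega
    set b : Fin n → k := fun r => f r 0 with hb
    have hupd : ∀ (g : Fin n → ℕ → k), (∀ r, g r 0 = f r 0) → ∀ (r : Fin n) (c : ℕ),
        (fun s => g s ((Pi.single r c : Fin n → ℕ) s)) = Function.update b r (g r c) := by
      intro g hg r c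
      have := update_point g 0 r c
      simp only [Pi.zero_apply, hg] at this
      exact this
    have hupd2 : ∀ (g : Fin n → ℕ → k), (∀ r, g r 0 = f r 0) → ∀ c c' : ℕ,
        (fun s => g s (Function.update (Pi.single L c' : Fin n → ℕ) i c s)) =
          Function.update (Function.update b i (g i c)) L (g L c') := by
      intro g hg c c'
      rw [update_point, hupd g hg, Function.update_comm (Ne.symm hi)]
    have hrow0 : rowDiff n l 0 = Pi.single i0 l := by
      rw [rowDiff_eq_update (i0 := i0) rfl hL h0L, Pi.single_zero]; rfl
    set α := topCoeff l (Pi.single i 1) H with hα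
    set α' := topCoeff l (Pi.single i 1) H' with hα'
    have hα0 : α ≠ 0 := by
      rw [hα, topCoeff_single_eq hsym l 1 i i0]
      refine topCoeff_ne_zero_of_row hdeg b i0 (f i0) (hinj i0) (fun c hc => ?_) ?_
      · rw [← hupd f fun _ => rfl]
        exact hzero _ (Nat.zero_le _) (by rw [sum_single_nat]; omega)
      · rw [← hupd f fun _ => rfl, ← hrow0]
        exact hne
    have hα0' : α' ≠ 0 := by
      rw [hα', topCoeff_single_eq hsym' l 1 i i0]
      refine topCoeff_ne_zero_of_row hdeg' b i0 _ (hTinj i0) (fun c hc => ?_) ?_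
      · rw [← hupd (fun r m => (affMap q d)^[m] (f r 0)) fun _ => rfl]
        exact hzero' _ (by rw [sum_single_nat]; omega)
      · rw [← hupd (fun r m => (affMap q d)^[m] (f r 0)) fun _ => rfl, ← hrow0]
        exact hne'
    -- This combination kills the leading coefficient in each coordinate direction, so D has degree
    -- below l in each variable separately.
    set D := C α' * H - C α * H' with hD
    have hDsym : D.IsSymmetric :=
      ((IsSymmetric.C α').mul hsym).sub ((IsSymmetric.C α).mul hsym')
    have hDdeg : D.totalDegree ≤ l := by
      refine (totalDegree_sub _ _).trans (max_le ?_ ?_) <;>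
        refine (totalDegree_mul _ _).trans ?_ <;> rw [totalDegree_C, zero_add] <;> assumption
    have hDtop : topCoeff l (Pi.single L 1) D = 0 := by
      rw [topCoeff_single_eq hDsym l 1 L i, hD, topCoeff_sub, topCoeff_C_mul, topCoeff_C_mul,
        ← hα, ← hα']
      ring
    have hDzero : ∀ x y, eval (Function.update (Function.update b i x) L y) D = 0 := by
      refine symmetric_eq_zero_of_zeros (l := l) (by omega)
        (K := fun x y => eval (Function.update (Function.update b i x) L y) D)
        (fun x y => eval_update_update_comm hDsym b hi x y) (fun x => ?_) ?_ (f := f i) (g := f L)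
        (fun _ _ _ _ h => hinj i h) (hinj L) (fun u _ v => hp.ne_last hOm hL hi u v)
        fun u v hu huv => ?_
      · refine ⟨linePoly (Function.update (Function.update b i x) L 0) (Pi.single L 1) D, ?_,
          fun y => eval_linePoly_single _ _ _ _⟩
        have h1 := natDegree_linePoly_le (Function.update (Function.update b i x) L 0)
          (Pi.single L 1) hDdeg
        have h2 := coeff_linePoly (Function.update (Function.update b i x) L 0)
          (Pi.single L 1) hDdeg
        rw [hDtop] at h2
        refine lt_of_le_of_ne h1 fun heq => ?_
        rw [← heq] at h2
        rw [Polynomial.leadingCoeff_eq_zero.1 h2, Polynomial.natDegree_zero] at heq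
        omega
      · refine ⟨linePoly (Function.update (Function.update b i 0) L 0)
          (Pi.single i 1 + Pi.single L 1) D, natDegree_linePoly_le _ _ hDdeg, fun s => ?_⟩
        rw [eval_linePoly]
        congr 2
        funext r
        by_cases h1 : r = L
        · subst h1; simp [Ne.symm hi]
        by_cases h2 : r = i
        · subst h2; simp [hi]
        · simp [h1, h2]
      · have hsum : ∑ r, Function.update (Pi.single L v : Fin n → ℕ) i u r < l := by
          rw [sum_update_single hi]; exact huv
        have e1 := hzero _ (Nat.zero_le _) hsum
        have e2 := hzero' _ hsum
        rw [hupd2 f fun _ => rfl] at e1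
        rw [hupd2 (fun r m => (affMap q d)^[m] (f r 0)) fun _ => rfl] at e2
        rw [← ih u (by omega), ← hL'] at e2
        rw [hD, map_sub, map_mul, map_mul, e1, e2]
        ring
    -- H' vanishes at this point because a < l, so H vanishes there as well.
    have hfinal := hDzero ((affMap q d)^[a] (f i 0)) (f L 0)
    rw [Function.update_comm hi, show Function.update b L (f L 0) = b from
      Function.update_eq_self _ _, hD, map_sub, map_mul, map_mul, eval_C, eval_C] at hfinal
    have e2 := hzero' (Pi.single i a) (by rw [sum_single_nat]; omega)
    rw [hupd (fun r m => (affMap q d)^[m] (f r 0)) fun _ => rfl] at e2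
    rw [e2, mul_zero, sub_zero] at hfinal
    have hroot := (mul_eq_zero.1 hfinal).resolve_left hα0'
    rw [eval_update_eq_of_roots hdeg b i (f i) (fun _ _ _ _ h => hinj i h) (fun c hc => by
      rw [← hupd f fun _ => rfl]
      exact hzero _ (Nat.zero_le _) (by rw [sum_single_nat]; omega))] at hroot
    obtain ⟨c, hc, hcz⟩ := prod_eq_zero_iff.1 ((mul_eq_zero.1 hroot).resolve_left hα0)
    have hc' := mem_range.1 hc
    have hca := sub_eq_zero.1 hcz
    rcases Nat.lt_or_ge c a with h | h
    · rw [ih c h] at hca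
      have := hTinj i hca
      omega
    · have : c = a := by omega
      rw [← this] at hca ⊢
      exact hca.symm

lemma IsPerfect.isGeometricType_or_isArithmeticType [CharZero k] (hp : IsPerfect Om)
    (hOm : ∀ (lam : Ptn n) (i : Fin n), Om lam i = f i (lam.1 i - nextPart lam.1 i))
    (hn : 3 ≤ n) : (∃ (c q : k) (a : Fin n → k), IsGeometricType f c q a) ∨
      (∃ (d : k) (c : Fin n → k), IsArithmeticType f d c) := by
  have hinj := fun i => hp.1.injective hOm i
  set L : Fin n := ⟨n - 1, by omega⟩ with hLdef
  have hL : (L : ℕ) + 1 = n := by simp [hLdef]; omega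
  obtain ⟨q, d, hlast, hone⟩ := hp.exists_affMap hOm hn hL
  have hq : q ≠ 0 := by
    rintro rfl
    have h1 := hlast 0
    have h2 := hlast 1
    simp only [affMap, zero_mul, zero_add] at h1 h2
    have := hinj L (h1.trans h2.symm)
    omega
  have hLt : ∀ t, f L t = (affMap q d)^[t] (f L 0) := by
    intro t
    induction t with
    | zero => rfl
    | succ t ih => rw [hlast, ih, Function.iterate_succ_apply']
  have hB : ∀ j, qNat q 1 (j + 1) ≠ 0 := by
    intro j hj
    rw [qNat, one_mul] at hj
    have h1 := mul_geom_sum q (j + 1)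
    have h2 := hLt (j + 1)
    rw [affMap_iterate_eq, hj] at h2
    rw [hj] at h1
    have : f L (j + 1) = f L 0 := by linear_combination h2 - f L 0 * h1
    have := hinj L this
    omega
  have hf := hp.eq_iterate hOm hn hL hq hB hlast hone
  -- A coincidence f_i(a) = f_j(b) propagates under T to f_i(a + 1) = f_j(b + 1). Then the
  -- differences (a + 1, b) and (a, b + 1) at i, j give grid points that are permutations of each
  -- other.
  have hdisj : ∀ i j, i ≠ j → ∀ a b, f i a ≠ f j b := by
    intro i j hij a b hab
    have hab' : f i (a + 1) = f j (b + 1) := by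
      rw [hf i, hf j, Function.iterate_succ_apply', Function.iterate_succ_apply', ← hf, ← hf, hab]
    refine hp.1.comp_perm_ne
      (lam := ptnOfDiff (Function.update (Pi.single i (a + 1)) j b))
      (mu := ptnOfDiff (Function.update (Pi.single i a) j (b + 1))) ?_ (Equiv.swap i j) ?_
    · intro h
      have := congrFun (ptnOfDiff_injective h) j
      simp at this
    · rw [grid_ptnOfDiff hOm, grid_ptnOfDiff hOm]
      funext r
      simp only [Function.comp_apply]
      by_cases h1 : r = i
      · subst h1; simp [hij, hab']
      by_cases h2 : r = j
      · subst h2; simp [hij, hab]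
      · simp [Equiv.swap_apply_of_ne_of_ne h1 h2, h1, h2]
  by_cases hq1 : q = 1
  · subst hq1
    right
    have hform : ∀ i j, f i j = f i 0 + (j : k) * d := fun i j => by
      rw [hf, affMap_arithmetic_iterate]
    refine ⟨d, fun i => f i 0, hform, ?_, fun i j hij z hz => ?_⟩
    · rintro rfl
      have := hform L 1
      rw [mul_zero, add_zero] at this
      exact one_ne_zero (hinj L this)
    -- The sign of z decides which of the two progressions is advanced to reach the other's starting
    -- point.
    · rcases Int.le_total 0 z with h | h
      · obtain ⟨m, rfl⟩ := Int.eq_ofNat_of_zero_le h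
        refine hdisj i j hij 0 m ?_
        rw [hform j]
        push_cast at hz
        linear_combination hz
      · obtain ⟨m, hm⟩ := Int.eq_ofNat_of_zero_le (neg_nonneg.2 h)
        obtain rfl : z = -(m : ℤ) := by omega
        refine hdisj i j hij m 0 ?_
        rw [hform i]
        push_cast at hz
        linear_combination hz
  · left
    have hq1' : (1 : k) - q ≠ 0 := sub_ne_zero.2 (Ne.symm hq1)
    -- The fixed point of T.
    set c := d / (1 - q) with hc
    have hd : d = c * (1 - q) := by rw [hc, div_mul_cancel₀ _ hq1']
    have hform : ∀ i j, f i j = c + (f i 0 - c) * q ^ j := fun i j => by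
      have := affMap_geometric_iterate q c (f i 0 - c) j
      rw [sub_add_cancel, ← hd, ← hf] at this
      rw [this, add_comm]
    have ha : ∀ i, f i 0 - c ≠ 0 := by
      intro i h
      have h1 := hform i 1
      rw [h, zero_mul, add_zero, ← sub_eq_zero.1 h] at h1
      exact one_ne_zero (hinj i h1)
    refine ⟨c, q, fun i => f i 0 - c, hform, hq, fun m hm h => ?_, ha, fun i j hij z hz => ?_⟩
    · have h1 := hform L m
      rw [h, mul_one, add_sub_cancel] at h1
      have := hinj L h1
      omega
    · rcases Int.le_total 0 z with h | h
      · obtain ⟨m, rfl⟩ := Int.eq_ofNat_of_zero_le h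
        rw [zpow_natCast, div_eq_iff (ha j)] at hz
        refine hdisj i j hij 0 m ?_
        rw [hform j]
        linear_combination hz
      · obtain ⟨m, hm⟩ := Int.eq_ofNat_of_zero_le (neg_nonneg.2 h)
        obtain rfl : z = -(m : ℤ) := by omega
        rw [zpow_neg, zpow_natCast, div_eq_iff (ha j)] at hz
        refine hdisj i j hij m 0 ?_
        rw [hform i, hz]
        have := pow_ne_zero m hq
        field_simp
        ring

end Classification

theorem theorem6p2 {k : Type*} [Field k] [CharZero k] (n : ℕ) (hn : 3 ≤ n)
    (f : Fin n → ℕ → k) (Om : Ptn n → Fin n → k)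
    (hOm : ∀ (lam : Ptn n) (i : Fin n), Om lam i = f i (lam.1 i - nextPart lam.1 i)) :
    (IsPerfect Om ↔
      (∃ (c q : k) (a : Fin n → k), IsGeometricType f c q a) ∨
        (∃ (d : k) (c : Fin n → k), IsArithmeticType f d c)) ∧
    (∀ (c q : k) (a : Fin n → k), IsGeometricType f c q a →
      ∀ A : ℕ → k, (∀ i : Fin n, A i = a i) →
      ∀ (lam : Ptn n) (F : MvPolynomial (Fin n) k), IsInterpolation Om lam F ↔
        ∃ s : k, s ≠ 0 ∧
          F = MvPolynomial.C s *
            qWhittakerInterp q A (fun i => MvPolynomial.X i - MvPolynomial.C c) lam) ∧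
    (∀ (d : k) (c : Fin n → k), IsArithmeticType f d c →
      ∀ C : ℕ → k, (∀ i : Fin n, C i = c i) →
      ∀ (lam : Ptn n) (F : MvPolynomial (Fin n) k), IsInterpolation Om lam F ↔
        ∃ s : k, s ≠ 0 ∧
          F = MvPolynomial.C s *
            elementaryInterp d C (fun i => MvPolynomial.X i) lam) := by
  refine ⟨⟨fun hp => hp.isGeometricType_or_isArithmeticType hOm hn, ?_⟩, ?_, ?_⟩
  · rintro (⟨c, q, a, h⟩ | ⟨d, c, h⟩)
    · exact (h.isAffineGrid (extendZero_val a) hOm).isPerfect h.qNat_ne_zero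
        (h.affineSeparated (extendZero_val a))
    · exact (h.isAffineGrid (extendZero_val c) hOm).isPerfect qNat_one_one_ne_zero
        (h.affineSeparated (extendZero_val c))
  · intro c q a h A hA lam F
    rw [qWhittakerInterp_eq_affInterp]
    exact (h.isAffineGrid hA hOm).isInterpolation_iff h.qNat_ne_zero (h.affineSeparated hA) lam F
  · intro d c h A hA lam F
    rw [elementaryInterp_eq_affInterp]
    exact (h.isAffineGrid hA hOm).isInterpolation_iff qNat_one_one_ne_zero
      (h.affineSeparated hA) lam F
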